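/- \textbf{Theorem (Born rule).} Let $\mathfrak A=\mathbb C\oplus\mathbb H\oplus M_3(\mathbb C)$ as a real $*$-algebra, and let $\mathcal H_F$ be a complex Hilbert space with $\dim_{\mathbb C}\mathcal H_F=48$ carrying a faithful unital real $*$-representation $\pi:\mathfrak A\to\mathcal B(\mathcal H_F)$ under which the summands $\mathbb C$ and $M_3(\mathbb C)$ are mapped onto complex subspaces, i.e. $\pi(\mathbb C)+i\pi(\mathbb C)=\pi(\mathbb C)$ and $\pi(M_3(\mathbb C))+i\pi(M_3(\mathbb C))=\pi(M_3(\mathbb C))$. Let $\mathfrak A_F^{\mathbb C}$ be the smallest complex $*$-subalgebra of $\mathcal B(\mathcal H_F)$ containing $\pi(\mathfrak A)$, and let $P_1,P_2,P_3$ (the Aperture outcomes) be the minimal projections of its center, labelled by the three summands of $\mathfrak A$. A coherent valuation of the Aperture outcomes is a map $V:\mathbb R^{\{1,2,3\}}\to\mathbb R$ that is linear, satisfies $V(f)\ge 0$ whenever $f\ge 0$, and satisfies $V(\mathbf 1)=1$. It induces on the record events $\sum_{\alpha\in S}P_\alpha$, $S\subseteq\{1,2,3\}$, the values $\sum_{\alpha\in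 S}V(e_\alpha)$, where $e_\alpha(\beta)=\delta_{\alpha\beta}$. Let $\mathcal P(\mathcal H_F)$ be the set of orthogonal projections of $\mathcal H_F$, and let $p:\mathcal P(\mathcal H_F)\to[0,1]$ be a function such that, for some coherent valuation $V$, \begin{enumerate} \item (extension) $p\bigl(\sum_{\alpha\in S}P_\alpha\bigr)=\sum_{\alpha\in S}V(e_\alpha)$ for every $S\subseteq\{1,2,3\}$; \item (normalization) $p(\mathbf I)=1$; \item (finite additivity) $p(\mathbf I)=p\bigl(\sum_k P'_k\bigr)=\sum_k p(P'_k)$ for every finite family of pairwise orthogonal projections $P'_k$ with $\sum_k P'_k=\mathbf I$; \end{enumerate} where noncontextuality is expressed by $p(P)$ being a function of the projection $P$ alone, independent of the orthogonal decomposition of $\mathbf I$ in which $P$ appears. Then there is a unique density operator $\rho$ on $\mathcal H_F$ (that is, $\rho\ge 0$ and $\operatorname{Tr}\rho=1$) such that $$p(P)=\operatorname{Tr}(\rho P)\qquad\text{for all }P\in\mathcal P(\mathcal H_F).$$ -/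

import Mathlib

open scoped Quaternion

namespace AccessibilityTheory

/-- The foundational real `*`-algebra `ℂ ⊕ ℍ ⊕ M₃(ℂ)`. -/
abbrev FoundationalAlgebra : Type :=
  ℂ × ℍ[ℝ] × Matrix (Fin 3) (Fin 3) ℂ

/-- The unit of each of the three simple summands of the foundational algebra. -/
noncomputable def summandUnit : Fin 3 → FoundationalAlgebra
  | 0 => (1, 0, 0)
  | 1 => (0, 1, 0)
  | 2 => (0, 0, 1)

theorem quaternion_im_eq_zero {q : ℍ[ℝ]} (h : ∀ t : ℍ[ℝ], q * t = t * q) :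
    q.imI = 0 ∧ q.imJ = 0 ∧ q.imK = 0 := by
  have d2 := fun t : ℍ[ℝ] => (Quaternion.imJ_mul q t).symm.trans
    ((congrArg (fun x : ℍ[ℝ] => x.imJ) (h t)).trans (Quaternion.imJ_mul t q))
  have d3 := fun t : ℍ[ℝ] => (Quaternion.imK_mul q t).symm.trans
    ((congrArg (fun x : ℍ[ℝ] => x.imK) (h t)).trans (Quaternion.imK_mul t q))
  have b1 := d3 ⟨0, 1, 0, 0⟩
  have b2 := d2 ⟨0, 1, 0, 0⟩
  have b3 := d3 ⟨0, 0, 1, 0⟩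
  refine ⟨?_, ?_, ?_⟩ <;> linarith

theorem quaternion_eq_smul_one {q : ℍ[ℝ]} (h : ∀ t : ℍ[ℝ], q * t = t * q) :
    q = q.re • (1 : ℍ[ℝ]) := by
  obtain ⟨h1, h2, h3⟩ := quaternion_im_eq_zero h
  apply Quaternion.ext <;>
    simp [h1, h2, h3, Quaternion.re_smul, Quaternion.imI_smul, Quaternion.imJ_smul,
      Quaternion.imK_smul]

section Hilbert

variable (H : Type*) [NormedAddCommGroup H] [InnerProductSpace ℂ H] [CompleteSpace H]

/-- A faithful unital `*`-representation of the (real) foundational algebra on a complex Hilbert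
space.  The summands `ℂ` and `M₃(ℂ)`, which are already complex algebras, are represented by
complex subspaces of `B(H)`, so that only the quaternionic summand is enlarged by complexification:
`π(ℂ) + iπ(ℂ) = π(ℂ)` and `π(M₃(ℂ)) + iπ(M₃(ℂ)) = π(M₃(ℂ))`. -/
structure InternalRepresentation where
  /-- the underlying unital real `*`-homomorphism -/
  toHom : FoundationalAlgebra →⋆ₐ[ℝ] (H →L[ℂ] H)
  faithful : Function.Injective toHom
  complex_scalar : ∀ z : ℂ, ∃ w : ℂ, Complex.I • toHom (z, 0, 0) = toHom (w, 0, 0)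
  complex_matrix : ∀ M : Matrix (Fin 3) (Fin 3) ℂ, ∃ N : Matrix (Fin 3) (Fin 3) ℂ,
    Complex.I • toHom (0, 0, M) = toHom (0, 0, N)

/-- The projection lattice of `H`: orthogonal projections, as self-adjoint idempotents. -/
abbrev Projection : Type _ := {P : H →L[ℂ] H // IsStarProjection P}

variable {H}

namespace InternalRepresentation

variable (π : InternalRepresentation H)

/-- The complex envelope: the smallest complex `*`-subalgebra of `B(H)` containing the image of
the representation. -/
noncomputable def complexEnvelope : StarSubalgebra ℂ (H →L[ℂ] H) :=
  StarAlgebra.adjoin ℂ (Set.range π.toHom)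

/-- The boundary algebra: the center of the complex envelope. -/
noncomputable def boundaryAlgebra : StarSubalgebra ℂ (H →L[ℂ] H) :=
  π.complexEnvelope ⊓ StarSubalgebra.centralizer ℂ (π.complexEnvelope : Set (H →L[ℂ] H))

/-- The minimal central projections: nonzero projections of the boundary algebra that dominate no
other nonzero projection of the boundary algebra (`r ≤ q` for projections means `r * q = r`). -/
structure IsMinimalCentralProjection (q : H →L[ℂ] H) : Prop where
  isStarProjection : IsStarProjection q
  mem : q ∈ π.boundaryAlgebra
  ne_zero : q ≠ 0
  minimal : ∀ r ∈ π.boundaryAlgebra, IsStarProjection r → r * q = r → r = 0 ∨ r = q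

/-- The support projection of the `α`-th simple summand. -/
noncomputable def sector (α : Fin 3) : H →L[ℂ] H := π.toHom (summandUnit α)

theorem summandUnit_isStarProjection (α : Fin 3) : IsStarProjection (summandUnit α) := by
  constructor
  · fin_cases α <;> simp [summandUnit, IsIdempotentElem]
  · fin_cases α <;> simp [summandUnit, IsSelfAdjoint, Prod.star_def]

theorem summandUnit_mul_of_ne {α β : Fin 3} (h : α ≠ β) :
    summandUnit α * summandUnit β = 0 := by
  fin_cases α <;> fin_cases β <;> simp_all [summandUnit]

theorem summandUnit_comm (α : Fin 3) (a : FoundationalAlgebra) :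
    summandUnit α * a = a * summandUnit α := by
  obtain ⟨a, b, c⟩ := a
  fin_cases α <;> simp [summandUnit]

theorem sum_summandUnit : ∑ α, summandUnit α = 1 := by
  simp [Fin.sum_univ_three, summandUnit]

theorem sector_isStarProjection (α : Fin 3) : IsStarProjection (π.sector α) :=
  (summandUnit_isStarProjection α).map π.toHom

theorem sector_mul_of_ne {α β : Fin 3} (h : α ≠ β) : π.sector α * π.sector β = 0 := by
  rw [sector, sector, ← map_mul, summandUnit_mul_of_ne h, map_zero]

theorem sector_ne_zero (α : Fin 3) : π.sector α ≠ 0 := by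
  intro h
  have : summandUnit α = 0 := π.faithful (by simpa [sector] using h)
  fin_cases α <;> simp [summandUnit] at this

theorem sector_injective : Function.Injective π.sector := by
  intro α β h
  by_contra hne
  have h1 := π.sector_mul_of_ne hne
  rw [← h, (π.sector_isStarProjection α).isIdempotentElem] at h1
  exact π.sector_ne_zero α h1

theorem sum_sector : ∑ α, π.sector α = 1 := by
  simp only [sector]
  rw [← map_sum, sum_summandUnit, map_one]

theorem mem_complexEnvelope (a : FoundationalAlgebra) : π.toHom a ∈ π.complexEnvelope :=
  StarAlgebra.subset_adjoin ℂ _ ⟨a, rfl⟩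

theorem exists_of_mem_complexEnvelope {T : H →L[ℂ] H} (hT : T ∈ π.complexEnvelope) :
    ∃ a b, T = π.toHom a + Complex.I • π.toHom b := by
  have hre : ∀ (r : ℝ) (a : FoundationalAlgebra), π.toHom (r • a) = (r : ℂ) • π.toHom a := by
    intro r a
    rw [map_smul]; ext x; simp
  induction hT using StarAlgebra.adjoin_induction with
  | mem x hx => obtain ⟨a, rfl⟩ := hx; exact ⟨a, 0, by simp⟩
  | algebraMap z =>
    refine ⟨z.re • 1, z.im • 1, ?_⟩
    rw [hre, hre, map_one, smul_smul, ← add_smul, Algebra.algebraMap_eq_smul_one]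
    congr 1
    rw [mul_comm]; exact (Complex.re_add_im z).symm
  | add x y _ _ hx hy =>
    obtain ⟨a, b, rfl⟩ := hx
    obtain ⟨c, d, rfl⟩ := hy
    exact ⟨a + c, b + d, by simp only [map_add, smul_add]; abel⟩
  | mul x y _ _ hx hy =>
    obtain ⟨a, b, rfl⟩ := hx
    obtain ⟨c, d, rfl⟩ := hy
    refine ⟨a * c - b * d, a * d + b * c, ?_⟩
    simp only [map_add, map_sub, map_mul, smul_add, add_mul, mul_add, smul_mul_assoc,
      mul_smul_comm, smul_smul, Complex.I_mul_I, neg_smul, one_smul]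
    abel
  | star x _ hx =>
    obtain ⟨a, b, rfl⟩ := hx
    refine ⟨star a, - star b, ?_⟩
    simp [map_star]

theorem sector_mem_boundaryAlgebra (α : Fin 3) : π.sector α ∈ π.boundaryAlgebra := by
  refine ⟨π.mem_complexEnvelope _, ?_⟩
  have key : ∀ T ∈ π.complexEnvelope, T * π.sector α = π.sector α * T := by
    intro T hT
    obtain ⟨a, b, rfl⟩ := π.exists_of_mem_complexEnvelope hT
    simp only [sector, add_mul, mul_add, smul_mul_assoc, mul_smul_comm, ← map_mul,
      summandUnit_comm α]
  refine StarSubalgebra.mem_centralizer_iff ℂ |>.2 fun T hT => ⟨key T hT, key _ (star_mem hT)⟩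

theorem comm_of_mem_boundaryAlgebra {r T : H →L[ℂ] H} (hr : r ∈ π.boundaryAlgebra)
    (hT : T ∈ π.complexEnvelope) : T * r = r * T :=
  (StarSubalgebra.mem_centralizer_iff ℂ |>.1 hr.2 T hT).1

/-- Complexified faithfulness of the quaternionic summand. -/
theorem quaternion_complex_injective {x y : ℍ[ℝ]}
    (h : π.toHom (0, x, 0) + Complex.I • π.toHom (0, y, 0) = 0) : x = 0 ∧ y = 0 := by
  have hy : y = 0 := by
    by_contra hy
    have h1 : π.toHom (0, x * y⁻¹, 0) = - (Complex.I • π.sector 1) := by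
      have := congrArg (· * π.toHom (0, y⁻¹, 0)) h
      simp only [add_mul, smul_mul_assoc, ← map_mul, zero_mul] at this
      rw [eq_neg_iff_add_eq_zero]
      simpa [hy, sector, summandUnit] using this
    set q := x * y⁻¹
    have h2 : q * q = -1 := by
      have : π.toHom (0, q * q, 0) = π.toHom (0, -1, 0) := by
        have e1 : ((0, q * q, 0) : FoundationalAlgebra) = (0, q, 0) * (0, q, 0) := by simp
        have e2 : ((0, -1, 0) : FoundationalAlgebra) = - summandUnit 1 := by simp [summandUnit]
        rw [e1, map_mul, h1, e2, map_neg]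
        rw [neg_mul_neg, smul_mul_smul_comm, Complex.I_mul_I,
          (π.sector_isStarProjection 1).isIdempotentElem.eq, neg_one_smul]
        rfl
      simpa using π.faithful this
    have h3 : ∀ t : ℍ[ℝ], q * t = t * q := by
      intro t
      have : π.toHom (0, q * t, 0) = π.toHom (0, t * q, 0) := by
        have e1 : ((0, q * t, 0) : FoundationalAlgebra) = (0, q, 0) * (0, t, 0) := by simp
        have e2 : ((0, t * q, 0) : FoundationalAlgebra) = (0, t, 0) * (0, q, 0) := by simp
        rw [e1, e2, map_mul, map_mul, h1]
        simp only [neg_mul, mul_neg, smul_mul_assoc, mul_smul_comm, sector, ← map_mul,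
          summandUnit_comm]
      simpa using π.faithful this
    have a1 := congrArg (fun q : ℍ[ℝ] => q.re) h2
    obtain ⟨c1, c2, c3⟩ := quaternion_im_eq_zero h3
    simp only [Quaternion.re_mul, Quaternion.re_neg, Quaternion.re_one] at a1
    rw [c1, c2, c3] at a1
    nlinarith [sq_nonneg q.re]
  subst hy
  refine ⟨?_, rfl⟩
  have e : ((0, 0, 0) : FoundationalAlgebra) = 0 := rfl
  rw [e, map_zero, smul_zero, add_zero] at h
  have : ((0, x, 0) : FoundationalAlgebra) = 0 := π.faithful (by simpa using h)
  simpa using this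

theorem real_smul_toHom (r : ℝ) (a : FoundationalAlgebra) :
    π.toHom (r • a) = (r : ℂ) • π.toHom a := by
  rw [map_smul]; ext x; simp

/-- A projection that is a scalar multiple of a sector projection is trivial. -/
theorem eq_zero_or_eq_of_eq_smul_sector {α : Fin 3} {r : H →L[ℂ] H} (hr : IsStarProjection r)
    {c : ℂ} (h : r = c • π.sector α) : r = 0 ∨ r = π.sector α := by
  have h1 := hr.isIdempotentElem.eq
  rw [h, smul_mul_smul_comm, (π.sector_isStarProjection α).isIdempotentElem.eq] at h1
  have h2 : c * c = c := smul_left_injective ℂ (π.sector_ne_zero α) h1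
  have h3 : c * (c - 1) = 0 := by linear_combination h2
  rcases mul_eq_zero.1 h3 with h4 | h4
  · left; rw [h, h4, zero_smul]
  · right; rw [h, sub_eq_zero.1 h4, one_smul]

/-- A projection of the boundary algebra below a sector projection is trivial. -/
theorem sector_minimal (α : Fin 3) {r : H →L[ℂ] H} (hb : r ∈ π.boundaryAlgebra)
    (hr : IsStarProjection r) (hle : r * π.sector α = r) : r = 0 ∨ r = π.sector α := by
  obtain ⟨⟨a₁, a₂, a₃⟩, ⟨b₁, b₂, b₃⟩, hab⟩ := π.exists_of_mem_complexEnvelope hb.1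
  have h0 : r = π.toHom ((a₁, a₂, a₃) * summandUnit α) +
      Complex.I • π.toHom ((b₁, b₂, b₃) * summandUnit α) := by
    conv_lhs => rw [← hle, hab]
    rw [add_mul, smul_mul_assoc, sector, ← map_mul, ← map_mul]
  fin_cases α
  · simp [summandUnit] at h0
    obtain ⟨w, hw⟩ := π.complex_scalar b₁
    rw [hw, ← map_add] at h0
    simp at h0
    have h1 := hr.isIdempotentElem.eq
    rw [h0, ← map_mul] at h1
    have h2 := π.faithful h1
    simp only [Prod.mk_mul_mk, mul_zero, Prod.mk.injEq, and_true] at h2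
    have h3 : (a₁ + w) * (a₁ + w - 1) = 0 := by linear_combination h2
    rcases mul_eq_zero.1 h3 with h4 | h4
    · left; rw [h0, h4]; exact map_zero π.toHom
    · right; rw [h0, sub_eq_zero.1 h4]; rfl
  · simp [summandUnit] at h0
    have hc : ∀ t : ℍ[ℝ], t * a₂ - a₂ * t = 0 ∧ t * b₂ - b₂ * t = 0 := by
      intro t
      apply π.quaternion_complex_injective
      have h1 := π.comm_of_mem_boundaryAlgebra hb (π.mem_complexEnvelope (0, t, 0))
      rw [h0, mul_add, add_mul, mul_smul_comm, smul_mul_assoc, ← map_mul, ← map_mul, ← map_mul,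
        ← map_mul] at h1
      simp only [Prod.mk_mul_mk, mul_zero] at h1
      have e : ∀ x y : ℍ[ℝ], ((0, x - y, 0) : FoundationalAlgebra) = (0, x, 0) - (0, y, 0) := by
        intro x y; simp
      rw [e, e, map_sub, map_sub, smul_sub, ← sub_eq_zero.2 h1]
      abel
    have hreal : ∀ x : ℍ[ℝ], (∀ t : ℍ[ℝ], t * x - x * t = 0) →
        ((0, x, 0) : FoundationalAlgebra) = x.re • summandUnit 1 := by
      intro x hx
      have hx' := quaternion_eq_smul_one fun t => (sub_eq_zero.1 (hx t)).symm
      simp only [summandUnit, Prod.smul_mk, smul_zero]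
      rw [← hx']
    rw [hreal a₂ fun t => (hc t).1, hreal b₂ fun t => (hc t).2, real_smul_toHom, real_smul_toHom,
      smul_smul, ← add_smul] at h0
    exact π.eq_zero_or_eq_of_eq_smul_sector hr h0
  · simp [summandUnit] at h0
    obtain ⟨N, hN⟩ := π.complex_matrix b₃
    rw [hN, ← map_add] at h0
    simp at h0
    have hc : ∀ M, (a₃ + N) * M = M * (a₃ + N) := by
      intro M
      have h1 := π.comm_of_mem_boundaryAlgebra hb (π.mem_complexEnvelope (0, 0, M))
      rw [h0, ← map_mul, ← map_mul] at h1
      have h2 := π.faithful h1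
      simp only [Prod.mk_mul_mk, mul_zero, Prod.mk.injEq] at h2
      exact h2.2.2.symm
    obtain ⟨c, hcN⟩ := Matrix.mem_range_scalar_of_commute_single
      (M := a₃ + N) fun i j _ => (hc _).symm
    rw [← hcN] at h0
    have h1 := hr.isIdempotentElem.eq
    rw [h0, ← map_mul] at h1
    have h2 := π.faithful h1
    simp only [Prod.mk_mul_mk, mul_zero, Prod.mk.injEq, true_and, ← map_mul] at h2
    have h3 : c * c = c := by simpa using congrFun (congrFun h2 0) 0
    have h4 : c * (c - 1) = 0 := by linear_combination h3
    rcases mul_eq_zero.1 h4 with h5 | h5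
    · left; rw [h0, h5, map_zero]; exact map_zero π.toHom
    · right; rw [h0, sub_eq_zero.1 h5, map_one]; rfl

theorem sector_isMinimalCentralProjection (α : Fin 3) :
    π.IsMinimalCentralProjection (π.sector α) where
  isStarProjection := π.sector_isStarProjection α
  mem := π.sector_mem_boundaryAlgebra α
  ne_zero := π.sector_ne_zero α
  minimal _ hb hr hle := π.sector_minimal α hb hr hle

theorem exists_sector_eq {q : H →L[ℂ] H} (hq : π.IsMinimalCentralProjection q) :
    ∃ α, π.sector α = q := by
  by_contra! hne
  have hz : ∀ α, q * π.sector α = 0 := by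
    intro α
    have hcomm : Commute q (π.sector α) :=
      π.comm_of_mem_boundaryAlgebra (π.sector_mem_boundaryAlgebra α) hq.mem.1
    have hp : IsStarProjection (q * π.sector α) :=
      hq.isStarProjection.mul (π.sector_isStarProjection α) hcomm
    have hm : q * π.sector α ∈ π.boundaryAlgebra :=
      mul_mem hq.mem (π.sector_mem_boundaryAlgebra α)
    have hle : q * π.sector α * q = q * π.sector α := by
      rw [mul_assoc, ← hcomm.eq, ← mul_assoc, hq.isStarProjection.isIdempotentElem.eq]
    rcases hq.minimal _ hm hp hle with h | h
    · exact h
    · rcases π.sector_minimal α hq.mem hq.isStarProjection h with h' | h'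
      · exact absurd h' hq.ne_zero
      · exact absurd h'.symm (hne α)
  apply hq.ne_zero
  rw [← mul_one q, ← π.sum_sector, Finset.mul_sum]
  exact Finset.sum_eq_zero fun α _ => hz α

/-- The three Aperture outcomes: the minimal central projections `P₁, P₂, P₃` of the boundary
algebra, labelled by the simple summands they come from. -/
noncomputable def aperture : Fin 3 ≃ {q : H →L[ℂ] H // π.IsMinimalCentralProjection q} :=
  Equiv.ofBijective (fun α => ⟨π.sector α, π.sector_isMinimalCentralProjection α⟩)
    ⟨fun _ _ h => π.sector_injective (congrArg Subtype.val h),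
      fun q => (π.exists_sector_eq q.2).imp fun _ h => Subtype.ext h⟩

theorem isStarProjection_sum_aperture (S : Finset (Fin 3)) :
    IsStarProjection (∑ α ∈ S, (π.aperture α : H →L[ℂ] H)) := by
  have h : ∑ α ∈ S, (π.aperture α : H →L[ℂ] H) = π.toHom (∑ α ∈ S, summandUnit α) := by
    rw [map_sum]; rfl
  rw [h]
  refine IsStarProjection.map ⟨?_, ?_⟩ π.toHom
  · rw [IsIdempotentElem, Finset.sum_mul_sum]
    refine Finset.sum_congr rfl fun α hα => ?_
    rw [Finset.sum_eq_single_of_mem α hα fun β _ hβ => summandUnit_mul_of_ne hβ.symm]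
    exact (summandUnit_isStarProjection α).isIdempotentElem
  · rw [IsSelfAdjoint, star_sum]
    exact Finset.sum_congr rfl fun α _ => (summandUnit_isStarProjection α).isSelfAdjoint

/-- The record event `∑ α ∈ S, P_α`; as `S` ranges over the subsets of the three outcomes these
are the elements of the Aperture record algebra. -/
noncomputable def recordEvent (S : Finset (Fin 3)) : Projection H :=
  ⟨∑ α ∈ S, (π.aperture α : H →L[ℂ] H), π.isStarProjection_sum_aperture S⟩

end InternalRepresentation

end Hilbert

/-- A coherent valuation of gambles `f : {1,2,3} → ℝ` over the three Aperture outcomes: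
linear, positive and normalized. -/
structure CoherentValuation where
  /-- the valuation functional -/
  value : (Fin 3 → ℝ) → ℝ
  linear : ∀ (a b : ℝ) (f g : Fin 3 → ℝ), value (a • f + b • g) = a * value f + b * value g
  nonneg : ∀ f : Fin 3 → ℝ, (∀ α, 0 ≤ f α) → 0 ≤ value f
  normalized : value (fun _ => 1) = 1

/-- The value that a coherent valuation induces on the record event `∑ α ∈ S, P_α`: the sum over
`α ∈ S` of `p_α`, the value of the gamble `e_α` that pays `1` on the outcome `α` only. -/
def CoherentValuation.prob (V : CoherentValuation) (S : Finset (Fin 3)) : ℝ :=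
  ∑ α ∈ S, V.value (Pi.single α 1)

section Assignments

variable {H : Type*} [NormedAddCommGroup H] [InnerProductSpace ℂ H] [CompleteSpace H]

/-- A normalized, finitely additive, noncontextual assignment on the full projection lattice.
Noncontextuality is that `p` is a function of the projection alone, so that the same number `p P`
enters the additivity condition of every orthogonal decomposition of the identity in which `P`
appears. -/
structure IsNoncontextualMeasure (p : Projection H → Set.Icc (0 : ℝ) 1) : Prop where
  normalized : (p ⟨1, IsStarProjection.one _⟩ : ℝ) = 1
  additive : ∀ (n : ℕ) (P : Fin n → Projection H),
    (∀ i j, i ≠ j → (P i : H →L[ℂ] H) * (P j : H →L[ℂ] H) = 0) →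
    ∑ k, (P k : H →L[ℂ] H) = 1 →
    (p ⟨1, IsStarProjection.one _⟩ : ℝ) = ∑ k, (p (P k) : ℝ)

/-- `p` extends the probability that the valuation `V` induces on the Aperture record algebra. -/
def Extends (p : Projection H → Set.Icc (0 : ℝ) 1) (π : InternalRepresentation H)
    (V : CoherentValuation) : Prop :=
  ∀ S : Finset (Fin 3), (p (π.recordEvent S) : ℝ) = V.prob S

/-- The trace of a bounded operator (on a finite-dimensional space). -/
noncomputable def trace (T : H →L[ℂ] H) : ℂ :=
  LinearMap.trace ℂ H (T : H →ₗ[ℂ] H)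

/-- Density operators: positive operators of trace one. -/
def IsDensityOperator (ρ : H →L[ℂ] H) : Prop :=
  ρ.IsPositive ∧ trace ρ = 1

end Assignments

end AccessibilityTheory

/-! This is Gleason's theorem in dimension at least four, proved by extremal arguments and without
assuming continuity. Additivity turns `p` into a bounded nonnegative frame function `f` on rays,
with the same sum over every orthonormal basis; the point is that `‖x‖² f(x)` is a quadratic form.

Take a unit vector `p` at which `f` is maximal. On a real three-space spanned by `p` and two vectors
orthogonal to it, adding to `f` its quarter turn about `p` makes it constant on the equator. After
subtracting that constant, the values of the resulting `Γ` at two orthogonal points of a great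
circle add up to its value at the summit of that circle. Maximality at `p` makes `Γ` decrease away
from the pole, and the sum rule makes it additive in the level `1 / (1 + ‖w‖²)`, the squared cosine
of the angle to the pole. A monotone additive function is linear, which gives `IsPolar.eq_div`.
Three mutually orthogonal vectors orthogonal to `p` allow the symmetrization to be undone
(`add_smul_of_max`), so the term `f(p) |⟨p, x⟩|²` splits off orthogonally. What remains is a
nonnegative frame function with a larger null space, and induction yields the operator
(`exists_operator_of_null`).

A maximum exists because the polar estimates survive an error `δ`: `f` stays close to its supremum
around any nearly maximal ray (`near_max`), and the unit sphere is compact. -/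

namespace Gleason

open Complex

/-! ### Polar functions and descent along tangents. -/

/-- A function on the plane `h = 1` over the equatorial plane `ℂ`, obtained from a frame function on
`ℂ × ℝ` that is constant on the equator, by subtracting the value on the equator; `δ` bounds the
amount by which the value at the pole fails to be maximal. -/
structure IsPolar (δ : ℝ) (Γ : ℂ → ℝ) : Prop where
  meridian : ∀ w : ℂ, w ≠ 0 → Γ w + Γ (-w / (‖w‖ ^ 2 : ℝ)) = Γ 0
  tangent : ∀ (w : ℂ) (t s : ℝ), w ≠ 0 → t * s * ‖w‖ ^ 2 = -(1 + ‖w‖ ^ 2) →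
    Γ ((1 + t * I) * w) + Γ ((1 + s * I) * w) = Γ w
  le_pole : ∀ w, Γ w ≤ Γ 0 + δ

theorem one_add_mul_I_ne_zero (t : ℝ) : (1 + t * I : ℂ) ≠ 0 := by
  intro h
  simpa using congrArg Complex.re h

theorem norm_one_add_mul_I_sq (t : ℝ) : ‖(1 + t * I : ℂ)‖ ^ 2 = 1 + t ^ 2 := by
  rw [← Complex.normSq_eq_norm_sq, Complex.normSq_apply]
  simp
  ring

theorem iterate_tangent_step {Γ : ℂ → ℝ} {δ : ℝ}
    (h : ∀ w : ℂ, w ≠ 0 → ∀ t : ℝ, Γ ((1 + t * I) * w) ≤ Γ w + δ) {w : ℂ} (hw : w ≠ 0) (t : ℝ)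
    (n : ℕ) : Γ ((1 + t * I) ^ n * w) ≤ Γ w + n * δ := by
  induction n with
  | zero => simp
  | succ n ih =>
    have h1 := h ((1 + t * I) ^ n * w) (mul_ne_zero (pow_ne_zero _ (one_add_mul_I_ne_zero t)) hw) t
    rw [pow_succ', mul_assoc]
    push_cast
    linarith

/-- Moving from `w` along tangents, one reaches every point which is farther from the origin by a
fixed factor, in a bounded number of steps. -/
theorem exists_tangent_step_count {c : ℝ} (hc : 1 < c) :
    ∃ N : ℕ, ∀ (Γ : ℂ → ℝ) (δ : ℝ),
      (∀ w : ℂ, w ≠ 0 → ∀ t : ℝ, Γ ((1 + t * I) * w) ≤ Γ w + δ) →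
      ∀ w w' : ℂ, w ≠ 0 → c * ‖w‖ ≤ ‖w'‖ → Γ w' ≤ Γ w + N * δ := by
  -- Multiplication by `1 + i tan x` turns by `x` and stretches by `1 / cos x`. Turning by an angle
  -- `φ` in `N` equal steps stretches by `cos(φ/N)⁻ᴺ`; Bernoulli's inequality keeps this at most `c`
  -- once `π² / (2N) ≤ 1 - 1/c`.
  obtain ⟨n, hn⟩ := exists_nat_gt (Real.pi ^ 2 / 2 / (1 - 1 / c))
  have hc0 : 0 < 1 - 1 / c := by
    rw [sub_pos, div_lt_one (by linarith)]; exact hc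
  set N := n + 3 with hN
  have hN3 : (3 : ℝ) ≤ N := by rw [hN]; push_cast; linarith [(Nat.cast_nonneg n : (0 : ℝ) ≤ n)]
  have hN0 : (0 : ℝ) < N := by linarith
  have hNn : (n : ℝ) ≤ N := by rw [hN]; push_cast; linarith
  have hb : Real.pi ^ 2 / (2 * N) ≤ 1 - 1 / c := by
    rw [div_lt_iff₀ hc0] at hn
    rw [div_le_iff₀ (by positivity)]
    nlinarith
  refine ⟨N + 2, fun Γ δ h w w' hw hww' => ?_⟩
  have hw0 : 0 < ‖w‖ := norm_pos_iff.2 hw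
  set ζ := w' / w with hζ
  have hζn : c ≤ ‖ζ‖ := by rw [hζ, norm_div, le_div_iff₀ hw0]; exact hww'
  set x := ζ.arg / N with hx
  have hxN : N * x = ζ.arg := by rw [hx]; field_simp
  have hφ : ζ.arg ^ 2 ≤ Real.pi ^ 2 := by
    rw [sq_le_sq, abs_of_pos Real.pi_pos]; exact Complex.abs_arg_le_pi ζ
  have hxsq : N * x ^ 2 / 2 ≤ 1 - 1 / c := by
    refine le_trans ?_ hb
    rw [hx, div_pow, div_le_div_iff₀ (by norm_num) (by positivity)]
    have : (N : ℝ) * (ζ.arg ^ 2 / N ^ 2) * (2 * N) = 2 * ζ.arg ^ 2 := by field_simp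
    linarith
  have hc1 : 1 / c > 0 := by positivity
  have hx2 : x ^ 2 / 2 ≤ 1 := by nlinarith [sq_nonneg x]
  have hcos1 : 1 - x ^ 2 / 2 ≤ Real.cos x := Real.one_sub_sq_div_two_le_cos
  have hpow : 1 / c ≤ Real.cos x ^ N := by
    calc 1 / c ≤ 1 + N * (-(x ^ 2 / 2)) := by linarith
      _ ≤ (1 + -(x ^ 2 / 2)) ^ N := one_add_mul_le_pow (by linarith) N
      _ ≤ Real.cos x ^ N := by
        apply pow_le_pow_left₀ <;> linarith
  have hcos0 : Real.cos x ≠ 0 := by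
    intro h0
    rw [h0, zero_pow (by omega)] at hpow
    linarith
  set κ := ‖ζ‖ * Real.cos x ^ N with hκ
  have hκ1 : 1 ≤ κ := by
    calc 1 = c * (1 / c) := by field_simp
      _ ≤ κ := by rw [hκ]; gcongr
  have hexp : (1 + (Real.tan x : ℝ) * I : ℂ) ^ N * (Real.cos x : ℝ) ^ N = exp (ζ.arg * I) := by
    rw [← mul_pow]
    have : (1 + (Real.tan x : ℝ) * I : ℂ) * (Real.cos x : ℝ) = exp (x * I) := by
      rw [Complex.exp_mul_I, ← Complex.ofReal_cos, ← Complex.ofReal_sin, Real.tan_eq_sin_div_cos]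
      have : ((Real.cos x : ℝ) : ℂ) ≠ 0 := by exact_mod_cast hcos0
      push_cast at this ⊢
      field_simp
    rw [this, ← Complex.exp_nat_mul, ← hxN]
    push_cast
    ring_nf
  -- The direction is now right and a radial factor `κ ≥ 1` is missing. The two steps `r` and `-r`
  -- supply it, since `(1 + ri)(1 - ri) = 1 + r² = κ`; hence `N + 2` steps in all.
  set r := √(κ - 1) with hr
  have hr2 : r ^ 2 = κ - 1 := Real.sq_sqrt (by linarith)
  set w₁ := (1 + (Real.tan x : ℝ) * I : ℂ) ^ N * w with hw₁
  have hw₁0 : w₁ ≠ 0 := mul_ne_zero (pow_ne_zero _ (one_add_mul_I_ne_zero _)) hw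
  have hw' : w' = (1 + ((-r : ℝ) : ℂ) * I) * ((1 + (r : ℂ) * I) * w₁) := by
    have e1 : (1 + ((-r : ℝ) : ℂ) * I) * (1 + (r : ℂ) * I) = (κ : ℂ) := by
      have : (κ : ℂ) = 1 + (r : ℂ) ^ 2 := by
        rw [← Complex.ofReal_pow, hr2]; push_cast; ring
      rw [this]
      push_cast
      linear_combination (-(r : ℂ) ^ 2) * Complex.I_sq
    rw [← mul_assoc, e1, hw₁, hκ]
    have e2 : w' = ζ * w := by rw [hζ]; field_simp
    rw [e2, ← mul_assoc]
    congr 1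
    conv_lhs => rw [← Complex.norm_mul_exp_arg_mul_I ζ, ← hexp]
    push_cast
    ring
  rw [hw']
  have s1 := iterate_tangent_step h hw (Real.tan x) N
  have s2 := h w₁ hw₁0 r
  have s3 := h _ (mul_ne_zero (one_add_mul_I_ne_zero r) hw₁0) (-r)
  push_cast at s1 s2 s3 ⊢
  push_cast [hw₁] at s2 s3 ⊢
  linarith

/-! ### Bounds for polar functions far from and near the pole. -/

namespace IsPolar

variable {δ : ℝ} {Γ : ℂ → ℝ}

/-- The orthogonal point on the same meridian takes at most `Γ 0 + δ` of the total `Γ 0`. -/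
theorem neg_le (h : IsPolar δ Γ) {w : ℂ} (hw : w ≠ 0) : -δ ≤ Γ w := by
  linarith [h.meridian w hw, h.le_pole (-w / (‖w‖ ^ 2 : ℝ))]

theorem nonneg (h : IsPolar δ Γ) : 0 ≤ δ := by
  linarith [h.le_pole 0]

/-- The orthogonal partner on the tangent has value at least `-δ`. For `t = 0` the partner would lie
on the equator, outside the chart. -/
theorem tangent_le (h : IsPolar δ Γ) (w : ℂ) (hw : w ≠ 0) (t : ℝ) :
    Γ ((1 + t * I) * w) ≤ Γ w + δ := by
  rcases eq_or_ne t 0 with rfl | ht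
  · simpa using h.nonneg
  · have hn : ‖w‖ ≠ 0 := norm_ne_zero_iff.2 hw
    have h1 := h.tangent w t (-(1 + ‖w‖ ^ 2) / (t * ‖w‖ ^ 2)) hw (by field_simp)
    have h2 := h.neg_le (mul_ne_zero
      (one_add_mul_I_ne_zero (-(1 + ‖w‖ ^ 2) / (t * ‖w‖ ^ 2))) hw)
    linarith

/-- With `δ = 0` the number of tangent steps costs nothing. The strict inequality is needed: nothing
is known yet about two points of the same latitude. -/
theorem le_of_norm_lt (h : IsPolar 0 Γ) {w w' : ℂ} (hww' : ‖w‖ < ‖w'‖) : Γ w' ≤ Γ w := by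
  rcases eq_or_ne w 0 with rfl | hw
  · simpa using h.le_pole w'
  · have hw0 : 0 < ‖w‖ := norm_pos_iff.2 hw
    obtain ⟨N, hN⟩ := exists_tangent_step_count ((one_lt_div hw0).2 hww')
    simpa using hN Γ 0 h.tangent_le w w' hw (by rw [div_mul_cancel₀ _ hw0.ne'])

/-- Splitting a level: `1 / (1 + ‖w‖²)` is written as a sum of two positive levels. -/
theorem exists_split (h : IsPolar δ Γ) {w : ℂ} (hw : w ≠ 0) {a b : ℝ} (ha : 0 < a) (hb : 0 < b)
    (hab : (a + b) * (1 + ‖w‖ ^ 2) = 1) :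
    ∃ x y : ℂ, a * (1 + ‖x‖ ^ 2) = 1 ∧ b * (1 + ‖y‖ ^ 2) = 1 ∧ Γ x + Γ y = Γ w := by
  have hw0 : 0 < ‖w‖ := norm_pos_iff.2 hw
  have hq : 1 + ‖w‖ ^ 2 = 1 / (a + b) := by field_simp; linarith
  have hw2 : ‖w‖ ^ 2 = (1 - a - b) / (a + b) := by
    rw [eq_div_iff (by positivity)]; linarith
  have hd : 0 < 1 - a - b := by
    have := sq_pos_of_pos hw0
    rw [hw2] at this
    exact (div_pos_iff_of_pos_right (by positivity)).1 this
  -- Obtained by solving `a (1 + (1 + t²) ‖w‖²) = 1` for `t²`; then `s` is forced by orthogonality.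
  set t := √(b / (a * (1 - a - b))) with ht
  have ht2 : t ^ 2 = b / (a * (1 - a - b)) := Real.sq_sqrt (by positivity)
  have ht0 : 0 < t := Real.sqrt_pos.2 (by positivity)
  set s := -(1 / (t * (1 - a - b))) with hs
  have hs2 : s ^ 2 = a / (b * (1 - a - b)) := by
    rw [hs, neg_sq, div_pow, mul_pow, ht2]
    field_simp
  refine ⟨(1 + t * I) * w, (1 + s * I) * w, ?_, ?_, h.tangent w t s hw ?_⟩
  · rw [norm_mul, mul_pow, norm_one_add_mul_I_sq, ht2, hw2]
    field_simp
    ring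
  · rw [norm_mul, mul_pow, norm_one_add_mul_I_sq, hs2, hw2]
    field_simp
    ring
  · rw [hq, hw2, hs]
    field_simp

/-- Points far from the origin have small values. -/
theorem exists_far_bound : ∃ N : ℕ, ∀ (δ : ℝ) (Γ : ℂ → ℝ), IsPolar δ Γ → ∀ (k : ℕ) (u : ℂ),
    (6 : ℝ) ^ k ≤ ‖u‖ ^ 2 → Γ u ≤ (Γ 0 + δ) / 2 ^ k + 2 * N * δ := by
  obtain ⟨N, hN⟩ := exists_tangent_step_count (c := √2) (by
    rw [Real.lt_sqrt] <;> norm_num)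
  refine ⟨N, fun δ Γ h k => ?_⟩
  have hδ := h.nonneg
  induction k with
  | zero => intro u _; have := h.le_pole u; have : 0 ≤ 2 * N * δ := by positivity
            simp; linarith
  | succ k ih =>
    intro u hu
    -- Splitting the level of `w` in halves gives points `z` with `‖z‖² = 1 + 2·6ᵏ`. Since `6·6ᵏ ≥
    -- 2(1 + 2·6ᵏ)`, the point `u` is farther out than both by the factor `√2`. So `2 Γ u ≤ Γ w +
    -- 2Nδ`, and the error `2Nδ` is the fixed point of `e ↦ e/2 + Nδ`.
    set w : ℂ := ((√(6 ^ k) : ℝ) : ℂ) with hw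
    have h6 : (1 : ℝ) ≤ 6 ^ k := one_le_pow₀ (by norm_num)
    have hwn : ‖w‖ ^ 2 = 6 ^ k := by
      rw [hw, Complex.norm_real, Real.norm_eq_abs, sq_abs, Real.sq_sqrt (by positivity)]
    have hw0 : w ≠ 0 := by
      intro h0; rw [h0] at hwn; simp at hwn; linarith
    have hl : (0 : ℝ) < 1 / (2 * (1 + 6 ^ k)) := by positivity
    obtain ⟨x, y, hx, hy, hxy⟩ := h.exists_split hw0 hl hl (by rw [hwn]; field_simp; norm_num)
    have key : ∀ z : ℂ, 1 / (2 * (1 + 6 ^ k)) * (1 + ‖z‖ ^ 2) = 1 → Γ u ≤ Γ z + N * δ := by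
      intro z hz
      have hz2 : ‖z‖ ^ 2 = 1 + 2 * 6 ^ k := by
        field_simp at hz
        linarith
      have hz0 : z ≠ 0 := by
        intro h0; rw [h0] at hz2; simp at hz2; linarith
      refine hN Γ δ h.tangent_le z u hz0 ?_
      refine (sq_le_sq₀ (by positivity) (norm_nonneg _)).1 ?_
      rw [mul_pow, Real.sq_sqrt (by norm_num), hz2]
      rw [pow_succ] at hu
      linarith
    have k1 := key x hx
    have k2 := key y hy
    have k3 := ih w hwn.ge
    have : (Γ 0 + δ) / 2 ^ (k + 1) = ((Γ 0 + δ) / 2 ^ k) / 2 := by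
      rw [pow_succ]; field_simp
    linarith

/-- Values near the pole are close to the value at the pole, uniformly. -/
theorem exists_near_bound (B : ℝ) {ε : ℝ} (hε : 0 < ε) : ∃ δ₀ > 0, ∃ r > 0,
    ∀ (δ : ℝ) (Γ : ℂ → ℝ), IsPolar δ Γ → δ ≤ δ₀ → Γ 0 ≤ B → ∀ w : ℂ, ‖w‖ ≤ r → Γ 0 - ε ≤ Γ w := by
  obtain ⟨N, hN⟩ := exists_far_bound
  obtain ⟨k, hk⟩ := pow_unbounded_of_one_lt (2 * (|B| + 1) / ε) (one_lt_two (α := ℝ))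
  -- The meridian partner of a point within `6^(-k/2)` of the pole has squared norm at least `6ᵏ`,
  -- so its value is small; `Γ w` is the rest of `Γ 0`. The choices of `k` and `δ₀` make each term
  -- of the far bound at most `ε / 2`.
  refine ⟨min 1 (ε / (4 * (N + 1))), by positivity, √((6 ^ k)⁻¹), by positivity, ?_⟩
  intro δ Γ h hδ hB w hw
  rcases eq_or_ne w 0 with rfl | hw0
  · linarith
  have hn : 0 < ‖w‖ := norm_pos_iff.2 hw0
  have h0 := h.nonneg
  have hm := h.meridian w hw0
  have hw2 : ‖w‖ ^ 2 ≤ (6 ^ k)⁻¹ := by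
    rw [← Real.sq_sqrt (show (0 : ℝ) ≤ (6 ^ k)⁻¹ by positivity)]
    gcongr
  have hf := hN δ Γ h k (-w / (‖w‖ ^ 2 : ℝ)) (by
    rw [norm_div, norm_neg, Complex.norm_real, Real.norm_eq_abs, abs_of_pos (by positivity),
      div_pow, show ‖w‖ ^ 2 / (‖w‖ ^ 2) ^ 2 = (‖w‖ ^ 2)⁻¹ by field_simp]
    exact (le_inv_comm₀ (by positivity) (by positivity)).1 hw2)
  have h1 : δ ≤ 1 := hδ.trans (min_le_left _ _)
  have h2 : δ ≤ ε / (4 * (N + 1)) := hδ.trans (min_le_right _ _)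
  rw [le_div_iff₀ (by positivity)] at h2
  have h3 : 2 * N * δ ≤ ε / 2 := by nlinarith
  have h4 : (Γ 0 + δ) / 2 ^ k ≤ ε / 2 := by
    rw [div_lt_iff₀ hε] at hk
    rw [div_le_iff₀ (by positivity)]
    have := le_abs_self B
    nlinarith
  linarith

/-! ### Additivity in the level and the exact polar formula. -/

/-- Induction on `k`, splitting off one piece of level `1 / n` at a time. The case `k = n` is the
pole, where no tangent splitting is available. -/
theorem nat_mul_bounds (h : IsPolar δ Γ) {n : ℕ} {c d : ℝ}
    (hx : ∀ x : ℂ, 1 / n * (1 + ‖x‖ ^ 2) = 1 → c ≤ Γ x ∧ Γ x ≤ d) (k : ℕ) (hk : 0 < k)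
    (hkn : k < n) (w : ℂ) (hw : k / n * (1 + ‖w‖ ^ 2) = 1) : k * c ≤ Γ w ∧ Γ w ≤ k * d := by
  have hn : (0 : ℝ) < n := by exact_mod_cast (hk.trans hkn)
  induction k, hk using Nat.le_induction generalizing w with
  | base => simpa using hx w (by simpa using hw)
  | succ k hk ih =>
    have hk' : (0 : ℝ) < k := by exact_mod_cast hk
    have hw0 : w ≠ 0 := by
      rintro rfl
      have : ((k + 1 : ℕ) : ℝ) < n := by exact_mod_cast hkn
      rw [norm_zero] at hw
      field_simp at hw
      norm_num at hw
      norm_num at this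
      linarith
    obtain ⟨x, y, h1, h2, h3⟩ := h.exists_split hw0 (a := k / n) (b := 1 / n) (by positivity)
      (by positivity) (by rw [← add_div]; push_cast at hw; exact hw)
    have i1 := ih (by omega) x h1
    have i2 := hx y h2
    push_cast
    constructor <;> linarith [i1.1, i1.2, i2.1, i2.2]

theorem exists_level {l : ℝ} (hl : 0 < l) (hl1 : l ≤ 1) : ∃ w : ℂ, l * (1 + ‖w‖ ^ 2) = 1 := by
  refine ⟨((√(1 / l - 1) : ℝ) : ℂ), ?_⟩
  have : 1 ≤ 1 / l := by rw [le_div_iff₀ hl]; linarith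
  rw [Complex.norm_real, Real.norm_eq_abs, sq_abs, Real.sq_sqrt (by linarith)]
  field_simp
  ring

/-- The last piece is added along a meridian: orthogonal points of a meridian have levels summing to
`1`, here `(n - 1) / n` and `1 / n`. -/
theorem nat_mul_pole_bounds (h : IsPolar δ Γ) {n : ℕ} (hn : 2 ≤ n) {c d : ℝ}
    (hx : ∀ x : ℂ, 1 / n * (1 + ‖x‖ ^ 2) = 1 → c ≤ Γ x ∧ Γ x ≤ d) :
    n * c ≤ Γ 0 ∧ Γ 0 ≤ n * d := by
  obtain ⟨m, rfl⟩ : ∃ m, n = m + 1 := ⟨n - 1, by omega⟩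
  have hm : (0 : ℝ) < m := by exact_mod_cast (by omega : 0 < m)
  obtain ⟨w, hw⟩ := exists_level (l := m / (m + 1 : ℕ)) (by positivity) (by
    rw [div_le_one (by positivity)]; push_cast; linarith)
  have hw2 : ‖w‖ ^ 2 = 1 / m := by
    field_simp at hw
    push_cast at hw
    field_simp
    linarith
  have hw0 : w ≠ 0 := by
    rintro rfl
    rw [norm_zero] at hw2
    have : (0 : ℝ) < 1 / m := by positivity
    linarith
  have h1 := h.nat_mul_bounds hx m (by omega) (by omega) w hw
  have h2 := hx (-w / (‖w‖ ^ 2 : ℝ)) (by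
    have hn : 0 < ‖w‖ := norm_pos_iff.2 hw0
    rw [norm_div, norm_neg, Complex.norm_real, Real.norm_eq_abs, abs_of_pos (by positivity),
      div_pow, show ‖w‖ ^ 2 / (‖w‖ ^ 2) ^ 2 = (‖w‖ ^ 2)⁻¹ by field_simp, hw2]
    push_cast
    field_simp
    ring)
  have h3 := h.meridian w hw0
  push_cast
  constructor <;> linarith [h1.1, h1.2, h2.1, h2.2]

theorem norm_lt_norm_of_level {a b : ℝ} (hab : b < a) (ha : 0 < a) {x y : ℂ}
    (hx : a * (1 + ‖x‖ ^ 2) = 1) (hy : b * (1 + ‖y‖ ^ 2) = 1) : ‖x‖ < ‖y‖ := by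
  by_contra! hle
  have : ‖y‖ ^ 2 ≤ ‖x‖ ^ 2 := by gcongr
  nlinarith [sq_nonneg ‖y‖]

/-- Every point of level `1 / n` is strictly nearer the pole than `x`, so has value at least `Γ x`,
and `n` such values make up `Γ 0`. Passing from `n + 1` to `n` is the price of strict monotonicity;
it vanishes in the limit. -/
theorem le_pole_div (h : IsPolar 0 Γ) {n : ℕ} (hn : 2 ≤ n) {x : ℂ}
    (hx : 1 / (n + 1 : ℕ) * (1 + ‖x‖ ^ 2) = 1) : n * Γ x ≤ Γ 0 := by
  have hn0 : (0 : ℝ) < n := by exact_mod_cast (by omega : 0 < n)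
  by_contra! hlt
  obtain ⟨d, hd⟩ : ∃ d, ∀ y : ℂ, Γ y ≤ d := ⟨_, h.le_pole⟩
  have := (h.nat_mul_pole_bounds hn (c := Γ x) (d := d) fun y hy =>
    ⟨h.le_of_norm_lt (norm_lt_norm_of_level (by
      push_cast; gcongr; linarith) (by positivity) hy hx), hd y⟩).1
  linarith

theorem pole_div_le (h : IsPolar 0 Γ) {n : ℕ} (hn : 2 ≤ n) {x : ℂ}
    (hx : 1 / n * (1 + ‖x‖ ^ 2) = 1) : Γ 0 ≤ (n + 1 : ℕ) * Γ x := by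
  have hn0 : (0 : ℝ) < n := by exact_mod_cast (by omega : 0 < n)
  refine (h.nat_mul_pole_bounds (n := n + 1) (by omega) (c := 0) (d := Γ x) fun y hy => ⟨?_, ?_⟩).2
  · have hy0 : y ≠ 0 := by
      rintro rfl
      rw [norm_zero] at hy
      push_cast at hy
      field_simp at hy
      linarith
    simpa using h.neg_le hy0
  · exact h.le_of_norm_lt (norm_lt_norm_of_level (by
      push_cast; gcongr; linarith) (by positivity) hx hy)

theorem mul_le (h : IsPolar 0 Γ) {w : ℂ} {l : ℝ} (hl : 0 < l) (hl1 : l < 1)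
    (hw : l * (1 + ‖w‖ ^ 2) = 1) : Γ w ≤ l * Γ 0 := by
  by_contra! hlt
  -- The level `l` is rounded up to `k / (n + 1) > l`, which gives `n Γ w ≤ k Γ 0 ≤ (l (n + 1) + 1)
  -- Γ 0`. The last bound on `n` contradicts this; `n > 1 / (1 - l)` keeps `k < n + 1`.
  obtain ⟨n, hn⟩ := exists_nat_gt (max 2 (max (1 / (1 - l)) ((l + 1) * Γ 0 / (Γ w - l * Γ 0))))
  simp only [max_lt_iff] at hn
  obtain ⟨hn2, hn3, hn4⟩ := hn
  rw [div_lt_iff₀ (by linarith)] at hn3 hn4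
  have hn2' : 2 ≤ n := by exact_mod_cast hn2.le
  set k := ⌊l * (n + 1)⌋₊ + 1 with hk
  have hk1 : (k : ℝ) ≤ l * (n + 1) + 1 := by
    have := Nat.floor_le (show 0 ≤ l * ((n : ℝ) + 1) by positivity)
    rw [hk]; push_cast; linarith
  have hk2 : l * (n + 1) < k := by
    have := Nat.lt_floor_add_one (l * ((n : ℝ) + 1))
    rw [hk]; push_cast; linarith
  have hkn : k < n + 1 := by
    have : (k : ℝ) < (n + 1 : ℕ) := by push_cast; nlinarith
    exact_mod_cast this
  obtain ⟨z, hz⟩ := exists_level (l := k / (n + 1 : ℕ)) (by positivity) (by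
    rw [div_le_one (by positivity)]; exact_mod_cast hkn.le)
  have h1 : Γ w ≤ Γ z := h.le_of_norm_lt (norm_lt_norm_of_level (by
    rw [lt_div_iff₀ (by positivity)]; push_cast; exact hk2) (by positivity) hz hw)
  have h2 := (h.nat_mul_bounds (n := n + 1) (c := 0) (d := Γ 0 / n) (fun x hx => ⟨?_, ?_⟩) k
    (by omega) hkn z hz).2
  · have hA : 0 ≤ Γ 0 := by
      have h1 := h.neg_le (w := 1) one_ne_zero
      have h2 := h.le_pole 1
      linarith
    have h3 : Γ w * n ≤ k * Γ 0 := by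
      have : k * (Γ 0 / n) = k * Γ 0 / n := by ring
      rw [this] at h2
      rw [← le_div_iff₀ (by linarith)]
      linarith
    nlinarith [mul_le_mul_of_nonneg_right hk1 hA]
  · have hx0 : x ≠ 0 := by
      rintro rfl
      rw [norm_zero] at hx
      push_cast at hx
      field_simp at hx
      linarith
    simpa using h.neg_le hx0
  · rw [le_div_iff₀ (by linarith), mul_comm]
    exact h.le_pole_div hn2' hx

theorem le_mul (h : IsPolar 0 Γ) {w : ℂ} {l : ℝ} (hl : 0 < l) (hl1 : l < 1)
    (hw : l * (1 + ‖w‖ ^ 2) = 1) : l * Γ 0 ≤ Γ w := by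
  by_contra! hlt
  -- Now `l` is rounded down to `k / n < l` with `k = ⌈l n⌉ - 1`; the bound `n > 2 / l` keeps `k`
  -- positive.
  obtain ⟨n, hn⟩ := exists_nat_gt (max 2 (max (2 / l) ((l + 1) * Γ 0 / (l * Γ 0 - Γ w))))
  simp only [max_lt_iff] at hn
  obtain ⟨hn2, hn3, hn4⟩ := hn
  rw [div_lt_iff₀ (by linarith)] at hn3 hn4
  have hn2' : 2 ≤ n := by exact_mod_cast hn2.le
  obtain ⟨k, hk⟩ : ∃ k, ⌈l * n⌉₊ = k + 1 :=
    Nat.exists_eq_add_one.2 (Nat.ceil_pos.2 (by nlinarith))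
  have hk1 : l * n - 1 ≤ k := by
    have := Nat.le_ceil (l * (n : ℝ))
    rw [hk] at this; push_cast at this; linarith
  have hk2 : k < l * n := by
    have := Nat.ceil_lt_add_one (show 0 ≤ l * (n : ℝ) by nlinarith)
    rw [hk] at this; push_cast at this; linarith
  have hk0 : 0 < k := by
    have : (0 : ℝ) < k := by nlinarith
    exact_mod_cast this
  have hk0' : (0 : ℝ) < k := by exact_mod_cast hk0
  have hkn : k < n := by
    have : (k : ℝ) < n := by nlinarith
    exact_mod_cast this
  obtain ⟨z, hz⟩ := exists_level (l := k / n) (by positivity) (by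
    rw [div_le_one (by positivity)]; exact_mod_cast hkn.le)
  have h1 : Γ z ≤ Γ w := h.le_of_norm_lt (norm_lt_norm_of_level (by
    rw [div_lt_iff₀ (by positivity)]; exact hk2) hl hw hz)
  have h2 := (h.nat_mul_bounds (n := n) (c := Γ 0 / (n + 1 : ℕ)) (d := Γ 0)
    (fun x hx => ⟨?_, by simpa using h.le_pole x⟩) k hk0 hkn z hz).1
  · have hA : 0 ≤ Γ 0 := by
      have h1 := h.neg_le (w := 1) one_ne_zero
      have h2 := h.le_pole 1
      linarith
    have h3 : k * Γ 0 ≤ Γ w * (n + 1) := by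
      have : k * (Γ 0 / (n + 1 : ℕ)) = k * Γ 0 / (n + 1) := by push_cast; ring
      rw [this] at h2
      rw [← div_le_iff₀ (by linarith)]
      linarith
    nlinarith [mul_le_mul_of_nonneg_right hk1 hA]
  · rw [div_le_iff₀ (by positivity), mul_comm]
    exact h.pole_div_le hn2' hx

/-- A polar function which is maximal at the pole is determined by its value there. -/
theorem eq_div (h : IsPolar 0 Γ) (w : ℂ) : Γ w = Γ 0 / (1 + ‖w‖ ^ 2) := by
  rcases eq_or_ne w 0 with rfl | hw
  · simp
  have hw0 : 0 < ‖w‖ := norm_pos_iff.2 hw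
  have hl1 : 1 / (1 + ‖w‖ ^ 2) < 1 := by
    rw [div_lt_one (by positivity)]
    nlinarith
  have hl : 1 / (1 + ‖w‖ ^ 2) * (1 + ‖w‖ ^ 2) = 1 := by field_simp
  rw [div_eq_mul_inv, mul_comm, ← one_div]
  exact le_antisymm (h.mul_le (by positivity) hl1 hl) (h.le_mul (by positivity) hl1 hl)

end IsPolar

/-! ### Frame functions on real three-space. -/

/-- A frame function on the punctured real three-space `ℂ × ℝ`, as a function of rays. -/
def IsSpaceFrame (f : ℂ × ℝ → ℝ) (W : ℝ) : Prop :=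
  ∀ a b c : ℂ × ℝ, a ≠ 0 → b ≠ 0 → c ≠ 0 →
    a.1.re * b.1.re + a.1.im * b.1.im + a.2 * b.2 = 0 →
    a.1.re * c.1.re + a.1.im * c.1.im + a.2 * c.2 = 0 →
    b.1.re * c.1.re + b.1.im * c.1.im + b.2 * c.2 = 0 → f a + f b + f c = W

theorem norm_sq_eq_re_add_im (w : ℂ) : ‖w‖ ^ 2 = w.re * w.re + w.im * w.im := by
  rw [← Complex.normSq_eq_norm_sq, Complex.normSq_apply]

theorem IsSpaceFrame.equator {f : ℂ × ℝ → ℝ} {W : ℝ} (hf : IsSpaceFrame f W) {w : ℂ}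
    (hw : w ≠ 0) : f (0, 1) + f (w, 0) + f (I * w, 0) = W :=
  hf _ _ _ (by simp) (by simpa using hw) (by simpa using hw) (by simp) (by simp) (by simp; ring)

theorem IsSpaceFrame.meridian {f : ℂ × ℝ → ℝ} {W : ℝ} (hf : IsSpaceFrame f W) {w : ℂ}
    (hw : w ≠ 0) : f (w, 1) + f (-w / (‖w‖ ^ 2 : ℝ), 1) + f (I * w, 0) = W := by
  have h0 : 0 < ‖w‖ := norm_pos_iff.2 hw
  have h1 : w.re * w.re + w.im * w.im ≠ 0 := by rw [← norm_sq_eq_re_add_im]; positivity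
  refine hf _ _ _ (by simp) (by simp) (by simpa using hw) ?_ ?_ ?_
  · rw [norm_sq_eq_re_add_im, Complex.div_ofReal_re, Complex.div_ofReal_im]
    simp only [neg_re, neg_im]
    linear_combination -(mul_inv_cancel₀ h1)
  · simp; ring
  · rw [Complex.div_ofReal_re, Complex.div_ofReal_im]
    simp
    ring

/-- Both pairs are orthogonal bases of the same plane, the orthogonal complement of `(-w, ‖w‖²)`. -/
theorem IsSpaceFrame.tangent {f : ℂ × ℝ → ℝ} {W : ℝ} (hf : IsSpaceFrame f W) {w : ℂ}
    (hw : w ≠ 0) {t s : ℝ} (h : t * s * ‖w‖ ^ 2 = -(1 + ‖w‖ ^ 2)) :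
    f ((1 + t * I) * w, 1) + f ((1 + s * I) * w, 1) = f (w, 1) + f (I * w, 0) := by
  have h1 := hf ((1 + t * I) * w, 1) ((1 + s * I) * w, 1) (-w, ‖w‖ ^ 2) (by simp) (by simp)
    (by simp [hw]) (by
      rw [norm_sq_eq_re_add_im] at h
      simp
      linear_combination h) (by simp [norm_sq_eq_re_add_im]; ring)
      (by simp [norm_sq_eq_re_add_im]; ring)
  have h2 := hf (w, 1) (I * w, 0) (-w, ‖w‖ ^ 2) (by simp) (by simp [hw])
    (by simp [hw]) (by simp; ring) (by simp [norm_sq_eq_re_add_im]; ring)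
      (by simp; ring)
  linarith

/-- Symmetrizing a frame function by a quarter turn makes it constant on the equator. -/
theorem IsSpaceFrame.isPolar {f : ℂ × ℝ → ℝ} {W : ℝ} (hf : IsSpaceFrame f W)
    (hneg : ∀ w, f (-w, 0) = f (w, 0)) {M : ℝ} (hM : ∀ w, f (w, 1) ≤ M) :
    IsPolar (2 * (M - f (0, 1))) fun w => f (w, 1) + f (I * w, 1) - (W - f (0, 1)) where
  meridian w hw := by
    have h1 := hf.meridian hw
    have h2 := hf.meridian (mul_ne_zero I_ne_zero hw)
    have h3 := hf.equator hw
    have e1 : I * (I * w) = -w := by rw [← mul_assoc, I_mul_I, neg_one_mul]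
    have e2 : -(I * w) / ((‖I * w‖ ^ 2 : ℝ) : ℂ) = I * (-w / (‖w‖ ^ 2 : ℝ)) := by
      rw [norm_mul, norm_I, one_mul]; ring
    rw [e1, e2, hneg] at h2
    simp only [mul_zero]
    linarith
  tangent w t s hw h := by
    have h1 := hf.tangent hw h
    have h2 := hf.tangent (w := I * w) (t := t) (s := s) (mul_ne_zero I_ne_zero hw)
      (by rwa [norm_mul, norm_I, one_mul])
    have h3 := hf.equator hw
    have e1 : I * (I * w) = -w := by rw [← mul_assoc, I_mul_I, neg_one_mul]
    rw [e1, hneg] at h2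
    have e2 : ∀ r : ℝ, I * ((1 + r * I) * w) = (1 + r * I) * (I * w) := fun r => by ring
    simp only [e2]
    linarith
  le_pole w := by
    simp only [mul_zero]
    linarith [hM w, hM (I * w)]

/-! ### Frame functions on a Hilbert space and their restrictions to real three-spaces. -/

section Hilbert

variable {H : Type*} [NormedAddCommGroup H] [InnerProductSpace ℂ H]

/-- A nonnegative bounded frame function, as a function of rays. -/
structure IsFrameFunction (f : H → ℝ) : Prop where
  smul : ∀ c : ℂ, c ≠ 0 → ∀ x, f (c • x) = f x
  sum : ∃ W : ℝ, ∀ b : OrthonormalBasis (Fin (Module.finrank ℂ H)) ℂ H, ∑ i, f (b i) = W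
  nonneg : ∀ x, 0 ≤ f x
  bdd : ∃ B, ∀ x, f x ≤ B

/-- The completely real three-space spanned by three vectors. -/
noncomputable def realSpace (u v p : H) (a : ℂ × ℝ) : H :=
  (a.1.re : ℂ) • u + (a.1.im : ℂ) • v + (a.2 : ℂ) • p

/-- The inner products are real, so orthogonality in `ℂ × ℝ`, seen as real three-space, becomes
orthogonality in `H`. -/
theorem inner_realSpace {u v p : H} (h : Orthonormal ℂ ![u, v, p]) (a b : ℂ × ℝ) :
    inner ℂ (realSpace u v p a) (realSpace u v p b) =
      ((a.1.re * b.1.re + a.1.im * b.1.im + a.2 * b.2 : ℝ) : ℂ) := by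
  have h' := orthonormal_iff_ite.1 h
  have h00 := h' 0 0
  have h01 := h' 0 1
  have h02 := h' 0 2
  have h10 := h' 1 0
  have h11 := h' 1 1
  have h12 := h' 1 2
  have h20 := h' 2 0
  have h21 := h' 2 1
  have h22 := h' 2 2
  simp only [Matrix.cons_val, Fin.reduceEq, if_true, if_false]
    at h00 h01 h02 h10 h11 h12 h20 h21 h22
  simp only [realSpace, inner_add_left, inner_add_right, inner_smul_left, inner_smul_right,
    Complex.conj_ofReal, h00, h01, h02, h10, h11, h12, h20, h21, h22]
  push_cast
  ring

theorem realSpace_ne_zero {u v p : H} (h : Orthonormal ℂ ![u, v, p]) {a : ℂ × ℝ} (ha : a ≠ 0) :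
    realSpace u v p a ≠ 0 := by
  intro h0
  have h1 := inner_realSpace h a a
  rw [h0, inner_zero_left] at h1
  have h2 : a.1.re * a.1.re + a.1.im * a.1.im + a.2 * a.2 = 0 := by exact_mod_cast h1.symm
  apply ha
  have i1 : a.1.re = 0 := by nlinarith [sq_nonneg a.1.re, sq_nonneg a.1.im, sq_nonneg a.2]
  have i2 : a.1.im = 0 := by nlinarith [sq_nonneg a.1.re, sq_nonneg a.1.im, sq_nonneg a.2]
  have i3 : a.2 = 0 := by nlinarith [sq_nonneg a.1.re, sq_nonneg a.1.im, sq_nonneg a.2]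
  exact Prod.ext (Complex.ext i1 i2) i3

theorem orthonormal_triple {u v p : H} (hu : ‖u‖ = 1) (hv : ‖v‖ = 1) (hp : ‖p‖ = 1)
    (huv : inner ℂ u v = 0) (hup : inner ℂ u p = 0) (hvp : inner ℂ v p = 0) :
    Orthonormal ℂ ![u, v, p] := by
  constructor
  · intro i; fin_cases i <;> simp [hu, hv, hp]
  · intro i j hij
    fin_cases i <;> fin_cases j <;> simp [huv, hup, hvp, inner_eq_zero_symm.1 huv,
      inner_eq_zero_symm.1 hup, inner_eq_zero_symm.1 hvp] at hij ⊢

variable [FiniteDimensional ℂ H]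

theorem exists_unit_mem_orthogonal (K : Submodule ℂ H)
    (hK : Module.finrank ℂ K < Module.finrank ℂ H) : ∃ x ∈ Kᗮ, ‖x‖ = 1 := by
  have hne : Kᗮ ≠ ⊥ := by
    intro h
    rw [Submodule.orthogonal_eq_bot_iff] at h
    rw [h, finrank_top] at hK
    exact lt_irrefl _ hK
  obtain ⟨x, hx, hx0⟩ := Submodule.exists_mem_ne_zero_of_ne_bot hne
  exact ⟨((‖x‖⁻¹ : ℝ) : ℂ) • x, Submodule.smul_mem _ _ hx, by
    rw [norm_smul, Complex.norm_real, Real.norm_eq_abs, abs_of_nonneg (by positivity),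
      inv_mul_cancel₀ (norm_ne_zero_iff.2 hx0)]⟩

theorem exists_unit_orthogonal_finset [DecidableEq H] (s : Finset H)
    (hs : s.card < Module.finrank ℂ H) : ∃ x : H, ‖x‖ = 1 ∧ ∀ y ∈ s, inner ℂ y x = 0 := by
  obtain ⟨x, hx, hx1⟩ := exists_unit_mem_orthogonal (Submodule.span ℂ (s : Set H))
    ((finrank_span_finset_le_card s).trans_lt hs)
  exact ⟨x, hx1, fun y hy => hx y (Submodule.subset_span hy)⟩

theorem exists_unit_orthogonal_two {p u : H} (h : 3 ≤ Module.finrank ℂ H) :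
    ∃ x : H, ‖x‖ = 1 ∧ inner ℂ p x = 0 ∧ inner ℂ u x = 0 := by
  classical
  obtain ⟨x, h1, h2⟩ := exists_unit_orthogonal_finset {p, u}
    (lt_of_le_of_lt Finset.card_le_two (by omega : 2 < Module.finrank ℂ H))
  exact ⟨x, h1, h2 p (by simp), h2 u (by simp)⟩

theorem exists_unit_orthogonal_three {p u v : H} (h : 4 ≤ Module.finrank ℂ H) :
    ∃ x : H, ‖x‖ = 1 ∧ inner ℂ p x = 0 ∧ inner ℂ u x = 0 ∧ inner ℂ v x = 0 := by
  classical
  obtain ⟨x, h1, h2⟩ := exists_unit_orthogonal_finset {p, u, v}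
    (lt_of_le_of_lt Finset.card_le_three (by omega : 3 < Module.finrank ℂ H))
  exact ⟨x, h1, h2 p (by simp), h2 u (by simp), h2 v (by simp)⟩

/-- An orthonormal basis of `K` is completed by one fixed orthonormal basis of `Kᗮ`. -/
theorem IsFrameFunction.sum_subspace {f : H → ℝ} (hf : IsFrameFunction f) (K : Submodule ℂ H)
    {k : ℕ} (hk : Module.finrank ℂ K = k) :
    ∃ W : ℝ, ∀ x : Fin k → H, Orthonormal ℂ x → (∀ i, x i ∈ K) → ∑ i, f (x i) = W := by
  obtain ⟨W, hW⟩ := hf.sum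
  set e := stdOrthonormalBasis ℂ Kᗮ
  refine ⟨W - ∑ j, f (e j), fun x hx hxK => ?_⟩
  have hadd := K.finrank_add_finrank_orthogonal
  set y : Fin k ⊕ Fin (Module.finrank ℂ Kᗮ) → H := Sum.elim x fun j => e j with hy
  have hyo : Orthonormal ℂ y := by
    rw [orthonormal_iff_ite]
    rintro (i | i) (j | j)
    · simpa [hy] using orthonormal_iff_ite.1 hx i j
    · simpa [hy] using (e j).2 _ (hxK i)
    · simpa [hy] using inner_eq_zero_symm.1 ((e i).2 _ (hxK j))
    · simpa [hy] using orthonormal_iff_ite.1 e.orthonormal i j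
  have hcard : Fintype.card (Fin k ⊕ Fin (Module.finrank ℂ Kᗮ)) = Module.finrank ℂ H := by
    simp [← hadd, hk]
  have hspan := hyo.linearIndependent.span_eq_top_of_card_eq_finrank' hcard
  have h1 := hW ((OrthonormalBasis.mk hyo hspan.ge).reindex (Fintype.equivFinOfCardEq hcard))
  simp only [OrthonormalBasis.reindex_apply, OrthonormalBasis.coe_mk] at h1
  rw [Equiv.sum_comp (Fintype.equivFinOfCardEq hcard).symm fun i => f (y i),
    Fintype.sum_sum_type] at h1
  simp only [hy, Sum.elim_inl, Sum.elim_inr] at h1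
  linarith

theorem IsFrameFunction.isSpaceFrame {f : H → ℝ} (hf : IsFrameFunction f) {u v p : H}
    (h : Orthonormal ℂ ![u, v, p]) : ∃ W, IsSpaceFrame (fun a => f (realSpace u v p a)) W := by
  set K := Submodule.span ℂ (Set.range ![u, v, p]) with hK
  have hk : Module.finrank ℂ K = 3 := by
    simpa using finrank_span_eq_card h.linearIndependent
  obtain ⟨W, hW⟩ := hf.sum_subspace K hk
  refine ⟨W, fun a b c ha hb hc hab hac hbc => ?_⟩
  have hmem : ∀ a, realSpace u v p a ∈ K := fun a => by
    have hm : ∀ i, ![u, v, p] i ∈ K := fun i => Submodule.subset_span ⟨i, rfl⟩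
    exact add_mem (add_mem (K.smul_mem _ (hm 0)) (K.smul_mem _ (hm 1))) (K.smul_mem _ (hm 2))
  set N : ℂ × ℝ → H := fun a => ((‖realSpace u v p a‖⁻¹ : ℝ) : ℂ) • realSpace u v p a with hN
  have hn : ∀ a, a ≠ 0 → ‖N a‖ = 1 := fun a ha => by
    rw [hN, norm_smul, Complex.norm_real, Real.norm_eq_abs, abs_of_nonneg (by positivity),
      inv_mul_cancel₀ (norm_ne_zero_iff.2 (realSpace_ne_zero h ha))]
  have hfN : ∀ a, a ≠ 0 → f (N a) = f (realSpace u v p a) := fun a ha =>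
    hf.smul _ (by simpa using realSpace_ne_zero h ha) _
  have hi : ∀ a b : ℂ × ℝ, a.1.re * b.1.re + a.1.im * b.1.im + a.2 * b.2 = 0 →
      inner ℂ (N a) (N b) = 0 := fun a b hab => by
    rw [hN, inner_smul_left, inner_smul_right, inner_realSpace h, hab]
    simp
  have h1 := hW ![N a, N b, N c] (orthonormal_triple (hn a ha) (hn b hb) (hn c hc) (hi _ _ hab)
    (hi _ _ hac) (hi _ _ hbc)) (fun i => by
      fin_cases i <;> exact K.smul_mem _ (hmem _))
  rw [Fin.sum_univ_three] at h1
  simpa [hfN a ha, hfN b hb, hfN c hc] using h1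

/-- The symmetrization of a frame function about a pole `p` is a polar function. -/
theorem IsFrameFunction.exists_isPolar {f : H → ℝ} (hf : IsFrameFunction f) {M : ℝ}
    (hM : ∀ x, x ≠ 0 → f x ≤ M) {u v p : H} (h : Orthonormal ℂ ![u, v, p]) :
    ∃ Γ : ℂ → ℝ, IsPolar (2 * (M - f p)) Γ ∧ Γ 0 = 2 * f p - (f u + f v) ∧
      ∀ r : ℝ, Γ r = f (p + (r : ℂ) • u) + f (p + (r : ℂ) • v) - (f u + f v) := by
  obtain ⟨W, hW⟩ := hf.isSpaceFrame h
  have h0 : realSpace u v p (0, 1) = p := by simp [realSpace]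
  have h1 : realSpace u v p (1, 0) = u := by simp [realSpace]
  have h2 : realSpace u v p (I, 0) = v := by simp [realSpace]
  have he := hW.equator one_ne_zero
  simp only [mul_one, h0, h1, h2] at he
  have hp := hW.isPolar (M := M) (fun w => by
    have : realSpace u v p (-w, 0) = (-1 : ℂ) • realSpace u v p (w, 0) := by
      simp [realSpace]
    rw [this, hf.smul _ (by norm_num)]) (fun w => hM _ (realSpace_ne_zero h (by simp)))
  simp only [h0] at hp
  refine ⟨_, hp, ?_, fun r => ?_⟩
  · simp only [mul_zero, h0]
    linarith
  · have e1 : realSpace u v p (r, 1) = p + (r : ℂ) • u := by simp [realSpace, add_comm]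
    have e2 : realSpace u v p (I * r, 1) = p + (r : ℂ) • v := by simp [realSpace, add_comm]
    rw [e1, e2]
    linarith

end Hilbert

/-! ### Existence of a maximum and reduction to a quadratic form. -/

section Hilbert

variable {H : Type*} [NormedAddCommGroup H] [InnerProductSpace ℂ H]

theorem norm_smul_add_sq {p y : H} (hp : ‖p‖ = 1) (hy : inner ℂ p y = 0) (c : ℂ) :
    ‖c • p + y‖ ^ 2 = ‖c‖ ^ 2 + ‖y‖ ^ 2 := by
  have := norm_add_sq_eq_norm_sq_add_norm_sq_of_inner_eq_zero (𝕜 := ℂ) (c • p) y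
    (by rw [inner_smul_left, hy, mul_zero])
  rw [← sq, ← sq, ← sq, norm_smul, hp, mul_one] at this
  exact this

theorem inner_sub_smul_self {p : H} (hp : ‖p‖ = 1) (x : H) :
    inner ℂ p (x - inner ℂ p x • p) = 0 := by
  rw [inner_sub_right, inner_smul_right, inner_self_eq_norm_sq_to_K, hp]
  simp

/-- Writing a vector with nonzero component along `p` as a multiple of `p + r u`. -/
theorem exists_smul_add_smul {p y : H} (hy : inner ℂ p y = 0) (hy0 : y ≠ 0) {c : ℂ}
    (hc : c ≠ 0) : ∃ (r : ℝ) (u : H) (k : ℂ), r * ‖c‖ = ‖y‖ ∧ ‖u‖ = 1 ∧ inner ℂ p u = 0 ∧ k ≠ 0 ∧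
      u = k • y ∧ c • p + y = c • (p + (r : ℂ) • u) := by
  have hn : 0 < ‖y‖ := norm_pos_iff.2 hy0
  have hcn : 0 < ‖c‖ := norm_pos_iff.2 hc
  have hr : ((‖y‖ / ‖c‖ : ℝ) : ℂ) ≠ 0 := by
    exact_mod_cast (div_pos hn hcn).ne'
  refine ⟨‖y‖ / ‖c‖, (((‖y‖ / ‖c‖ : ℝ) : ℂ) * c)⁻¹ • y, (((‖y‖ / ‖c‖ : ℝ) : ℂ) * c)⁻¹,
    by field_simp, ?_, by rw [inner_smul_right, hy, mul_zero], inv_ne_zero (mul_ne_zero hr hc),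
    rfl, ?_⟩
  · rw [norm_smul, norm_inv, norm_mul, Complex.norm_real, Real.norm_eq_abs,
      abs_of_pos (div_pos hn hcn)]
    field_simp
  · rw [smul_add, smul_smul, smul_smul, mul_comm c, mul_inv_cancel₀ (mul_ne_zero hr hc), one_smul]

variable [FiniteDimensional ℂ H]

namespace IsFrameFunction

variable {f : H → ℝ}

/-- This replaces continuity at the supremum. The polar function about `q` has a small error `2 (M -
f q)`, so `f (q + ρu) + f (q + ρv) ≥ 2 f q - ε / 2`; as the second term is at most `M`, the first is
close to `M`. -/
theorem near_max (hf : IsFrameFunction f) (h3 : 3 ≤ Module.finrank ℂ H) {M : ℝ}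
    (hM : ∀ x, x ≠ 0 → f x ≤ M) {ε : ℝ} (hε : 0 < ε) :
    ∃ η > 0, ∀ p q : H, ‖p‖ = 1 → ‖q‖ = 1 → M - η ≤ f q → ‖p - q‖ ≤ η → M - ε ≤ f p := by
  obtain ⟨δ₀, hδ₀, r, hr, hΓ⟩ := IsPolar.exists_near_bound (2 * M) (half_pos hε)
  -- The first two bounds control `M - f q`. The last two give `‖c‖ ≥ 1/2` and `‖y‖ ≤ r/2` for `p =
  -- c • q + y`, hence a slope `ρ = ‖y‖ / ‖c‖ ≤ r`.
  refine ⟨min (min (δ₀ / 2) (ε / 4)) (min (1 / 2) (r / 2)), by positivity, ?_⟩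
  intro p q hp hq hfq hpq
  simp only [le_min_iff] at hpq
  obtain ⟨-, hpq2, hpqr⟩ := hpq
  have hm1 : M - δ₀ / 2 ≤ f q := by
    linarith [(min_le_left (min (δ₀ / 2) (ε / 4)) (min (1 / 2) (r / 2))).trans (min_le_left _ _)]
  have hm2 : M - ε / 4 ≤ f q := by
    linarith [(min_le_left (min (δ₀ / 2) (ε / 4)) (min (1 / 2) (r / 2))).trans (min_le_right _ _)]
  set c := inner ℂ q p with hc
  set y := p - c • q with hy
  have hqy : inner ℂ q y = 0 := inner_sub_smul_self hq p
  have hpy : p = c • q + y := by rw [hy]; abel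
  have hsub : ‖p - q‖ ^ 2 = ‖c - 1‖ ^ 2 + ‖y‖ ^ 2 := by
    rw [← norm_smul_add_sq hq hqy, sub_smul, one_smul]
    congr 2
    rw [hy]; abel
  have hyle : ‖y‖ ≤ ‖p - q‖ := by
    refine (sq_le_sq₀ (norm_nonneg _) (norm_nonneg _)).1 ?_
    nlinarith [sq_nonneg ‖c - 1‖]
  have hcle : ‖c - 1‖ ≤ ‖p - q‖ := by
    refine (sq_le_sq₀ (norm_nonneg _) (norm_nonneg _)).1 ?_
    nlinarith [sq_nonneg ‖y‖]
  have hc2 : 1 / 2 ≤ ‖c‖ := by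
    have := norm_sub_norm_le (1 : ℂ) c
    rw [norm_one, norm_sub_rev] at this
    linarith
  have hc0 : c ≠ 0 := norm_pos_iff.1 (by linarith)
  rcases eq_or_ne y 0 with hy0 | hy0
  · rw [hpy, hy0, add_zero, hf.smul c hc0]
    linarith
  obtain ⟨ρ, u, k, hρ, hu, hqu, -, -, he⟩ := exists_smul_add_smul hqy hy0 hc0
  obtain ⟨v, hv, hqv, huv⟩ := exists_unit_orthogonal_two (p := q) (u := u) h3
  obtain ⟨Γ, h1, h2, h4⟩ := hf.exists_isPolar hM (orthonormal_triple hu hv hq huv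
    (inner_eq_zero_symm.1 hqu) (inner_eq_zero_symm.1 hqv))
  have hρ0 : 0 ≤ ρ := by
    by_contra! hlt
    nlinarith [norm_nonneg y]
  have hρr : ρ ≤ r := by
    nlinarith
  have h5 := hΓ _ Γ h1 (by linarith) (by
    have := hf.nonneg u
    have := hf.nonneg v
    have := hM q (norm_pos_iff.1 (by rw [hq]; exact one_pos))
    linarith) ρ (by rw [Complex.norm_real, Real.norm_eq_abs, abs_of_nonneg hρ0]; exact hρr)
  rw [h4, h2] at h5
  have h6 := hM (q + (ρ : ℂ) • v) (by
    intro h0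
    have := congrArg (inner ℂ q) h0
    rw [inner_add_right, inner_smul_right, hqv, inner_self_eq_norm_sq_to_K, hq] at this
    simp at this)
  rw [hpy, he, hf.smul c hc0]
  linarith

/-- A bounded frame function attains its supremum. -/
theorem exists_max (hf : IsFrameFunction f) (h3 : 3 ≤ Module.finrank ℂ H) :
    ∃ p : H, ‖p‖ = 1 ∧ ∀ x, x ≠ 0 → f x ≤ f p := by
  obtain ⟨B, hB⟩ := hf.bdd
  set S := Set.image f (Metric.sphere (0 : H) 1) with hS
  have hbdd : BddAbove S := ⟨B, by rintro _ ⟨x, -, rfl⟩; exact hB x⟩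
  have hne : S.Nonempty := by
    obtain ⟨x, hx, -⟩ := exists_unit_orthogonal_two (p := (0 : H)) (u := 0) h3
    exact ⟨f x, x, by simpa using hx, rfl⟩
  have hM : ∀ x, x ≠ 0 → f x ≤ sSup S := fun x hx => by
    have hx' : ((‖x‖⁻¹ : ℝ) : ℂ) ≠ 0 := by simpa using hx
    rw [← hf.smul _ hx' x]
    refine le_csSup hbdd ⟨_, ?_, rfl⟩
    rw [mem_sphere_zero_iff_norm, norm_smul, Complex.norm_real, Real.norm_eq_abs,
      abs_of_nonneg (by positivity), inv_mul_cancel₀ (norm_ne_zero_iff.2 hx)]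
  obtain ⟨s, -, hs, hsS⟩ := exists_seq_tendsto_sSup hne hbdd
  choose q hq hqs using hsS
  have : ProperSpace H := FiniteDimensional.proper ℂ H
  obtain ⟨p, hp, φ, hφ, hlim⟩ := (isCompact_sphere (0 : H) 1).tendsto_subseq hq
  have hp1 : ‖p‖ = 1 := by simpa using hp
  refine ⟨p, hp1, fun x hx => (hM x hx).trans ?_⟩
  refine le_of_forall_pos_sub_le fun ε hε => ?_
  obtain ⟨η, hη, h⟩ := hf.near_max h3 hM hε
  have e1 := (hs.comp hφ.tendsto_atTop).eventually_const_le (sub_lt_self (sSup S) hη)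
  have e2 := (Metric.tendsto_nhds.1 hlim) η hη
  obtain ⟨n, h1, h2⟩ := (e1.and e2).exists
  refine h p (q (φ n)) hp1 (by simpa using hq (φ n)) ?_ ?_
  · rw [hqs]; exact h1
  · rw [← dist_eq_norm, dist_comm]; exact h2.le

/-- Around a maximum a frame function is quadratic. -/
theorem add_smul_of_max (hf : IsFrameFunction f) (h4 : 4 ≤ Module.finrank ℂ H) {p : H}
    (hp : ‖p‖ = 1) (hM : ∀ x, x ≠ 0 → f x ≤ f p) {u : H} (hu : ‖u‖ = 1)
    (hpu : inner ℂ p u = 0) (r : ℝ) : (1 + r ^ 2) * f (p + (r : ℂ) • u) = f p + r ^ 2 * f u := by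
  obtain ⟨v, hv, hpv, huv⟩ := exists_unit_orthogonal_two (p := p) (u := u) (by omega)
  obtain ⟨w, hw, hpw, huw, hvw⟩ := exists_unit_orthogonal_three (p := p) (u := u) (v := v) h4
  have key : ∀ a b : H, ‖a‖ = 1 → ‖b‖ = 1 → inner ℂ a b = 0 → inner ℂ p a = 0 → inner ℂ p b = 0 →
      (1 + r ^ 2) * (f (p + (r : ℂ) • a) + f (p + (r : ℂ) • b)) =
        2 * f p + r ^ 2 * (f a + f b) := by
    intro a b ha hb hab hpa hpb
    obtain ⟨Γ, h1, h2, h3⟩ := hf.exists_isPolar hM (orthonormal_triple ha hb hp hab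
      (inner_eq_zero_symm.1 hpa) (inner_eq_zero_symm.1 hpb))
    rw [sub_self, mul_zero] at h1
    have h5 := h1.eq_div r
    rw [h3, h2, Complex.norm_real, Real.norm_eq_abs, sq_abs, eq_div_iff (by positivity)] at h5
    linarith
  -- The polar formula controls only sums over pairs; the combination `k1 + k2 - k3` isolates `u`.
  -- This is where a fourth dimension enters.
  have k1 := key u v hu hv huv hpu hpv
  have k2 := key u w hu hw huw hpu hpw
  have k3 := key v w hv hw hvw hpv hpw
  linarith

theorem quadratic_of_max (hf : IsFrameFunction f) (h4 : 4 ≤ Module.finrank ℂ H) {p : H}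
    (hp : ‖p‖ = 1) (hM : ∀ x, x ≠ 0 → f x ≤ f p) {y : H} (hpy : inner ℂ p y = 0) (c : ℂ) :
    ‖c • p + y‖ ^ 2 * f (c • p + y) = ‖c‖ ^ 2 * f p + ‖y‖ ^ 2 * f y := by
  rcases eq_or_ne c 0 with rfl | hc
  · simp
  rcases eq_or_ne y 0 with rfl | hy
  · simp [norm_smul, hp, hf.smul c hc]
  obtain ⟨r, u, k, hr, hu, hpu, hk, huk, he⟩ := exists_smul_add_smul hpy hy hc
  have h1 := hf.add_smul_of_max h4 hp hM hu hpu r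
  rw [norm_smul_add_sq hp hpy, he, hf.smul c hc, ← hr, ← hf.smul k hk y, ← huk]
  linear_combination ‖c‖ ^ 2 * h1

theorem quadratic_decomposition (hf : IsFrameFunction f) (h4 : 4 ≤ Module.finrank ℂ H) {p : H}
    (hp : ‖p‖ = 1) (hM : ∀ x, x ≠ 0 → f x ≤ f p) (x : H) :
    ‖x‖ ^ 2 * f x = f p * ‖inner ℂ p x‖ ^ 2 +
      ‖x - inner ℂ p x • p‖ ^ 2 * f (x - inner ℂ p x • p) := by
  have := hf.quadratic_of_max h4 hp hM (inner_sub_smul_self hp x) (inner ℂ p x)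
  rw [add_sub_cancel] at this
  rw [this]
  ring

/-- The frame function that remains after the contribution of the vector state of `p` is removed. -/
theorem sub_vector (hf : IsFrameFunction f) (h4 : 4 ≤ Module.finrank ℂ H) {p : H}
    (hp : ‖p‖ = 1) (hM : ∀ x, x ≠ 0 → f x ≤ f p) :
    IsFrameFunction fun x => f x - f p * ‖(inner ℂ p x : ℂ)‖ ^ 2 / ‖x‖ ^ 2 where
  smul c hc x := by
    have : ‖c‖ ≠ 0 := norm_ne_zero_iff.2 hc
    rw [hf.smul c hc, inner_smul_right, norm_mul, norm_smul, mul_pow, mul_pow,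
      mul_left_comm, mul_div_mul_left _ _ (by positivity)]
  sum := by
    obtain ⟨W, hW⟩ := hf.sum
    -- By Parseval, the squared coefficients of the unit vector `p` sum to `1`.
    refine ⟨W - f p, fun b => ?_⟩
    have := b.sum_sq_norm_inner_left p
    simp only [Finset.sum_sub_distrib, hW, b.norm_eq_one, one_pow, div_one, ← Finset.mul_sum, this,
      hp, mul_one]
  nonneg x := by
    rcases eq_or_ne x 0 with rfl | hx
    · simpa using hf.nonneg 0
    · have hn : 0 < ‖x‖ := norm_pos_iff.2 hx
      have h1 := hf.quadratic_decomposition h4 hp hM x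
      have h2 := mul_nonneg (sq_nonneg ‖x - inner ℂ p x • p‖) (hf.nonneg (x - inner ℂ p x • p))
      rw [sub_nonneg, div_le_iff₀ (by positivity)]
      linarith
  bdd := by
    obtain ⟨B, hB⟩ := hf.bdd
    refine ⟨B, fun x => (sub_le_self _ ?_).trans (hB x)⟩
    have := hf.nonneg p
    positivity

/-- Induction on the codimension of a subspace `N` along which the form `‖x‖² f(x)` is translation
invariant. Removing the vector state of a maximum `p` enlarges `N` by the line of `p`. -/
theorem exists_operator_of_null (h4 : 4 ≤ Module.finrank ℂ H) (d : ℕ) :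
    ∀ (f : H → ℝ) (N : Submodule ℂ H), IsFrameFunction f →
      Module.finrank ℂ H - Module.finrank ℂ N ≤ d →
      (∀ x, ∀ z ∈ N, ‖x + z‖ ^ 2 * f (x + z) = ‖x‖ ^ 2 * f x) →
      ∃ T : H →L[ℂ] H, ∀ x, ((‖x‖ ^ 2 * f x : ℝ) : ℂ) = inner ℂ x (T x) := by
  induction d with
  | zero =>
    intro f N _ hd hN
    have hNtop : N = ⊤ := Submodule.eq_top_of_finrank_eq
      (le_antisymm N.finrank_le (by omega))
    refine ⟨0, fun x => ?_⟩
    have := hN 0 x (hNtop ▸ Submodule.mem_top)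
    simp only [zero_add, norm_zero] at this
    simp [this]
  | succ d ih =>
    intro f N hf hd hN
    obtain ⟨p, hp, hM⟩ := hf.exists_max (by omega)
    rcases (hf.nonneg p).eq_or_lt with hp0 | hp0
    · refine ⟨0, fun x => ?_⟩
      rcases eq_or_ne x 0 with rfl | hx
      · simp
      · have : f x = 0 := le_antisymm ((hM x hx).trans hp0.ge) (hf.nonneg x)
        simp [this]
    -- Removing from `p` its component `z` in `N` leaves the form unchanged: `‖p - z‖² f(p - z) = f
    -- p > 0`. Maximality gives `f(p - z) ≤ f p`, so `‖p - z‖ ≥ 1`, and Pythagoras forces `z = 0`.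
    have hpN : ∀ z ∈ N, inner ℂ p z = 0 := by
      set z := N.starProjection p with hz
      have hzN : z ∈ N := N.starProjection_apply_mem p
      have hyN : p - z ∈ Nᗮ := N.sub_starProjection_mem_orthogonal p
      have h1 := hN p (-z) (N.neg_mem hzN)
      rw [← sub_eq_add_neg, hp, one_pow, one_mul] at h1
      have hy0 : p - z ≠ 0 := by
        intro h0
        rw [h0] at h1
        simp at h1
        linarith
      have h2 := hM _ hy0
      have h3 : 1 ≤ ‖p - z‖ ^ 2 := by
        by_contra! hlt
        nlinarith [sq_nonneg ‖p - z‖]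
      have h5 := norm_add_sq_eq_norm_sq_add_norm_sq_of_inner_eq_zero (𝕜 := ℂ) z (p - z)
        (hyN z hzN)
      rw [add_sub_cancel, hp] at h5
      have h6 : z = 0 := norm_eq_zero.1 (by nlinarith [norm_nonneg z])
      rw [h6, sub_zero] at hyN
      exact fun z hz => inner_eq_zero_symm.1 (hyN z hz)
    have hdec := hf.quadratic_decomposition h4 hp hM
    have hF : ∀ x, ‖x‖ ^ 2 * (f x - f p * ‖(inner ℂ p x : ℂ)‖ ^ 2 / ‖x‖ ^ 2) =
        ‖x‖ ^ 2 * f x - f p * ‖(inner ℂ p x : ℂ)‖ ^ 2 := by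
      intro x
      rcases eq_or_ne x 0 with rfl | hx
      · simp
      · have hn : ‖x‖ ≠ 0 := norm_ne_zero_iff.2 hx
        field_simp
    obtain ⟨T, hT⟩ := ih (fun x => f x - f p * ‖(inner ℂ p x : ℂ)‖ ^ 2 / ‖x‖ ^ 2)
      (N ⊔ Submodule.span ℂ {p}) (hf.sub_vector h4 hp hM) (by
        have hlt : N < N ⊔ Submodule.span ℂ {p} := by
          refine lt_of_le_of_ne le_sup_left fun heq => ?_
          have : p ∈ N := by
            rw [heq]; exact Submodule.mem_sup_right (Submodule.mem_span_singleton_self p)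
          have := hpN p this
          rw [inner_self_eq_zero] at this
          rw [this] at hp
          simp at hp
        have := Submodule.finrank_lt_finrank_of_lt hlt
        omega) (by
        intro x z hz
        obtain ⟨n, hn, q, hq, rfl⟩ := Submodule.mem_sup.1 hz
        obtain ⟨c, rfl⟩ := Submodule.mem_span_singleton.1 hq
        -- The reduced form at `x` is the old form at the component of `x` orthogonal to `p`.
        -- Translation by `n + c • p` moves that component only by `n`, which the old form does not
        -- see.
        rw [hF, hF, hdec, hdec x, add_sub_cancel_left, add_sub_cancel_left]
        have e : x + (n + c • p) - (inner ℂ p (x + (n + c • p)) : ℂ) • p =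
            (x - (inner ℂ p x : ℂ) • p) + n := by
          rw [inner_add_right, inner_add_right, hpN n hn, inner_smul_right,
            inner_self_eq_norm_sq_to_K, hp]
          simp only [ofReal_one, one_pow, mul_one, zero_add, add_smul, coe_algebraMap]
          abel
        rw [e, hN _ n hn])
    refine ⟨T + (f p : ℂ) • InnerProductSpace.rankOne ℂ p p, fun x => ?_⟩
    have h1 := hT x
    rw [hF] at h1
    rw [add_apply, inner_add_right, ← h1, smul_apply,
      inner_smul_right, InnerProductSpace.rankOne_apply, inner_smul_right,
      ← inner_conj_symm x p, Complex.mul_conj, Complex.normSq_eq_norm_sq]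
    push_cast
    ring

/-- Every nonnegative bounded frame function in dimension at least four is a quadratic form. -/
theorem exists_operator (hf : IsFrameFunction f) (h4 : 4 ≤ Module.finrank ℂ H) :
    ∃ T : H →L[ℂ] H, ∀ x, ((‖x‖ ^ 2 * f x : ℝ) : ℂ) = inner ℂ x (T x) :=
  exists_operator_of_null h4 _ f ⊥ hf le_rfl fun x z hz => by
    rw [(Submodule.mem_bot ℂ).1 hz, add_zero]

end IsFrameFunction

end Hilbert

end Gleason

/-! ### From measures on projections to density operators. -/

namespace Gleason

open AccessibilityTheory

section Hilbert

theorem trace_mul_sum {H : Type*} [NormedAddCommGroup H] [InnerProductSpace ℂ H]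
    {ι : Type*} (s : Finset ι) (T : H →L[ℂ] H) (P : ι → H →L[ℂ] H) :
    AccessibilityTheory.trace (T * ∑ i ∈ s, P i) = ∑ i ∈ s, AccessibilityTheory.trace (T * P i) := by
  simp only [AccessibilityTheory.trace, Finset.mul_sum]
  rw [← map_sum]
  congr 1
  ext x
  simp

variable {H : Type*} [NormedAddCommGroup H] [InnerProductSpace ℂ H] [CompleteSpace H]

/-- The orthogonal projection onto the line spanned by a vector. -/
noncomputable def rayProjection (x : H) : Projection H :=
  ⟨(Submodule.span ℂ {x}).starProjection, isStarProjection_starProjection⟩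

theorem rayProjection_smul {c : ℂ} (hc : c ≠ 0) (x : H) :
    rayProjection (c • x) = rayProjection x := by
  simp only [rayProjection]
  congr 2
  exact Submodule.span_singleton_smul_eq hc.isUnit x

theorem coe_rayProjection {x : H} (hx : ‖x‖ = 1) :
    (rayProjection x : H →L[ℂ] H) = InnerProductSpace.rankOne ℂ x x := by
  ext y
  simp [rayProjection, Submodule.starProjection_unit_singleton ℂ hx]

theorem rayProjection_mul_of_inner_eq_zero {x y : H} (hx : ‖x‖ = 1) (hy : ‖y‖ = 1)
    (hxy : inner ℂ x y = 0) :
    (rayProjection x : H →L[ℂ] H) * (rayProjection y : H →L[ℂ] H) = 0 := by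
  ext z
  simp [coe_rayProjection hx, coe_rayProjection hy, hxy]

variable {p : Projection H → Set.Icc (0 : ℝ) 1}

theorem apply_add_apply_compl (hp : IsNoncontextualMeasure p) {P Q : Projection H}
    (hQ : (Q : H →L[ℂ] H) = 1 - P) : (p P : ℝ) + p Q = 1 := by
  have hid := P.2.isIdempotentElem.eq
  have h := hp.additive 2 ![P, Q] (by
    intro i j hij
    fin_cases i <;> fin_cases j <;> simp [hQ, mul_sub, sub_mul, hid] at hij ⊢) (by simp [hQ])
  rw [hp.normalized] at h
  simpa using h.symm

theorem sum_rayProjection_add_compl (hp : IsNoncontextualMeasure p) {k : ℕ} {b : Fin k → H}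
    (hb : Orthonormal ℂ b) {Q : Projection H}
    (hQ : (Q : H →L[ℂ] H) = 1 - ∑ i, (rayProjection (b i) : H →L[ℂ] H)) :
    (p Q : ℝ) + ∑ i, (p (rayProjection (b i)) : ℝ) = 1 := by
  have hbb : ∀ i j, i ≠ j →
      (rayProjection (b i) : H →L[ℂ] H) * (rayProjection (b j) : H →L[ℂ] H) = 0 :=
    fun i j hij => rayProjection_mul_of_inner_eq_zero (hb.1 i) (hb.1 j) (hb.2 hij)
  have hid : ∀ i, (rayProjection (b i) : H →L[ℂ] H) * (rayProjection (b i) : H →L[ℂ] H) =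
      rayProjection (b i) := fun i => (rayProjection (b i)).2.isIdempotentElem.eq
  have h := hp.additive (k + 1) (Fin.cons Q fun i => rayProjection (b i)) (by
    intro i j
    refine Fin.cases ?_ (fun i => ?_) i <;> refine Fin.cases ?_ (fun j => ?_) j
    · simp
    · intro _
      simp only [Fin.cons_zero, Fin.cons_succ]
      rw [hQ, sub_mul, one_mul, Finset.sum_mul, Finset.sum_eq_single j
        (fun i _ hij => hbb i j hij) (by simp), hid, sub_self]
    · intro _
      simp only [Fin.cons_zero, Fin.cons_succ]
      rw [hQ, mul_sub, mul_one, Finset.mul_sum, Finset.sum_eq_single i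
        (fun j _ hij => hbb i j hij.symm) (by simp), hid, sub_self]
    · intro hij
      simp only [Fin.cons_succ]
      exact hbb i j fun h => hij (by rw [h])) (by
    rw [Fin.sum_univ_succ]
    simp only [Fin.cons_zero, Fin.cons_succ]
    rw [hQ, sub_add_cancel])
  rw [hp.normalized, Fin.sum_univ_succ] at h
  simpa using h.symm

/-- Additivity is given only for decompositions of the identity. The coarse one `{P, 1 - P}` and its
refinement of `P` into rays share `1 - P`, whose value is the same in both by noncontextuality. -/
theorem apply_eq_sum_rayProjection (hp : IsNoncontextualMeasure p) {k : ℕ} {b : Fin k → H}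
    (hb : Orthonormal ℂ b) {P : Projection H}
    (hP : (P : H →L[ℂ] H) = ∑ i, (rayProjection (b i) : H →L[ℂ] H)) :
    (p P : ℝ) = ∑ i, (p (rayProjection (b i)) : ℝ) := by
  have h1 := apply_add_apply_compl hp (P := P) (Q := ⟨1 - P, P.2.one_sub⟩) rfl
  have h2 := sum_rayProjection_add_compl hp hb (Q := ⟨1 - P, P.2.one_sub⟩) (by rw [← hP])
  linarith

/-- A noncontextual measure restricts to a frame function on rays. -/
theorem isFrameFunction_rayProjection (hp : IsNoncontextualMeasure p) :
    IsFrameFunction fun x : H => (p (rayProjection x) : ℝ) where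
  smul c hc x := by rw [rayProjection_smul hc]
  sum := by
    refine ⟨1, fun b => ?_⟩
    have hone : (1 : H →L[ℂ] H) = ∑ i, (rayProjection (b i) : H →L[ℂ] H) := by
      simp only [coe_rayProjection (b.norm_eq_one _), b.sum_rankOne_eq_id]
      rfl
    exact (apply_eq_sum_rayProjection hp (P := ⟨1, IsStarProjection.one _⟩) b.orthonormal
      hone).symm.trans hp.normalized
  nonneg x := (p _).2.1
  bdd := ⟨1, fun x => (p _).2.2⟩

variable [FiniteDimensional ℂ H]

theorem trace_mul_rayProjection (T : H →L[ℂ] H) {x : H} (hx : ‖x‖ = 1) :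
    AccessibilityTheory.trace (T * (rayProjection x : H →L[ℂ] H)) = inner ℂ x (T x) := by
  rw [coe_rayProjection hx, ContinuousLinearMap.mul_def, InnerProductSpace.comp_rankOne]
  exact InnerProductSpace.trace_rankOne _ _

/-- Every projection is a sum of pairwise orthogonal ray projections. -/
theorem exists_sum_rayProjection (P : Projection H) : ∃ (k : ℕ) (b : Fin k → H), Orthonormal ℂ b ∧
    (P : H →L[ℂ] H) = ∑ i, (rayProjection (b i) : H →L[ℂ] H) := by
  obtain ⟨K, _, hK⟩ := isStarProjection_iff_eq_starProjection.1 P.2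
  set b := stdOrthonormalBasis ℂ K
  refine ⟨_, fun i => (b i : H), b.orthonormal.comp_linearIsometry K.subtypeₗᵢ, ?_⟩
  rw [hK, b.starProjection_eq_sum_rankOne]
  exact Finset.sum_congr rfl fun i _ => (coe_rayProjection (x := (b i : H)) (b.norm_eq_one i)).symm

/-- **Gleason's theorem** in finite dimension at least four. -/
theorem exists_unique_densityOperator (h4 : 4 ≤ Module.finrank ℂ H)
    (hp : IsNoncontextualMeasure p) :
    ∃! ρ : H →L[ℂ] H, IsDensityOperator ρ ∧
      ∀ P : Projection H, ((p P : ℝ) : ℂ) = AccessibilityTheory.trace (ρ * (P : H →L[ℂ] H)) := by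
  obtain ⟨T, hT⟩ := (isFrameFunction_rayProjection hp).exists_operator h4
  have hrepr : ∀ P : Projection H,
      ((p P : ℝ) : ℂ) = AccessibilityTheory.trace (T * (P : H →L[ℂ] H)) := by
    intro P
    obtain ⟨k, b, hb, hP⟩ := exists_sum_rayProjection P
    rw [apply_eq_sum_rayProjection hp hb hP, hP, trace_mul_sum]
    push_cast
    refine Finset.sum_congr rfl fun i _ => ?_
    rw [trace_mul_rayProjection T (hb.1 i), ← hT, hb.1 i]
    simp
  refine ⟨T, ⟨⟨?_, ?_⟩, hrepr⟩, ?_⟩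
  · rw [ContinuousLinearMap.isPositive_iff_complex]
    intro x
    rw [← inner_conj_symm, ← hT, Complex.conj_ofReal]
    exact ⟨congrArg _ (Complex.ofReal_re _),
      (mul_nonneg (sq_nonneg ‖x‖) (p (rayProjection x)).2.1).trans_eq (Complex.ofReal_re _).symm⟩
  · have := hrepr ⟨1, IsStarProjection.one _⟩
    rw [hp.normalized, mul_one] at this
    simpa using this.symm
  · rintro S ⟨-, hS⟩
    -- Over `ℂ` an operator is determined by its quadratic form (polarization), and ray projections
    -- determine the form on unit vectors.
    rw [← ContinuousLinearMap.coe_inj, ← ext_inner_map]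
    have hunit : ∀ x : H, ‖x‖ = 1 → inner ℂ x (S x) = inner ℂ x (T x) := fun x hx => by
      rw [← trace_mul_rayProjection S hx, ← trace_mul_rayProjection T hx, ← hS, ← hrepr]
    intro x
    rcases eq_or_ne x 0 with rfl | hx
    · simp
    have h1 := hunit (((‖x‖⁻¹ : ℝ) : ℂ) • x) (by
      rw [norm_smul, Complex.norm_real, Real.norm_eq_abs, abs_of_nonneg (by positivity),
        inv_mul_cancel₀ (norm_ne_zero_iff.2 hx)])
    have hc : ((‖x‖⁻¹ : ℝ) : ℂ) ≠ 0 := by simpa using hx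
    rw [map_smul, map_smul, inner_smul_left, inner_smul_left, inner_smul_right, inner_smul_right,
      Complex.conj_ofReal] at h1
    have h2 := mul_left_cancel₀ hc (mul_left_cancel₀ hc h1)
    rw [ContinuousLinearMap.coe_coe, ContinuousLinearMap.coe_coe, ← inner_conj_symm,
      ← inner_conj_symm (T x), h2]

end Hilbert

end Gleason

theorem mainTheorem1 {H : Type*} [NormedAddCommGroup H] [InnerProductSpace ℂ H] [CompleteSpace H]
    (hdim : Module.finrank ℂ H = 48)
    (π : AccessibilityTheory.InternalRepresentation H)
    (V : AccessibilityTheory.CoherentValuation)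
    (p : AccessibilityTheory.Projection H → Set.Icc (0 : ℝ) 1)
    (hp : AccessibilityTheory.IsNoncontextualMeasure p)
    (hext : AccessibilityTheory.Extends p π V) :
    ∃! ρ : H →L[ℂ] H, AccessibilityTheory.IsDensityOperator ρ ∧
      ∀ P : AccessibilityTheory.Projection H,
        ((p P : ℝ) : ℂ) = AccessibilityTheory.trace (ρ * (P : H →L[ℂ] H)) := by
  -- `Module.finrank` is `0` in infinite dimension, so a positive value forces finite dimension.
  have : FiniteDimensional ℂ H := Module.finite_of_finrank_pos (by omega)
  exact Gleason.exists_unique_densityOperator (by omega) hp
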